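/- **Theorem 1.1 ($L^1$ initial density).** Let $\kappa\in\mathbb R$, $u_0\in C^1(\mathbb R)$, $\rho_0\in L^1(\mathbb R)$ with $\rho_0\ge 0$ a.e. Put $E_0(s)=\int_{-\infty}^s\rho_0(w)\,dw$ and, for $x\in\mathbb R$, $t\ge 0$, $$Q_{x,t}(s)=s+tu_0(s)+\tfrac12\kappa E_0(s)t^2-x,\qquad F_{x,t}(y)=\int_0^yQ_{x,t}(s)\rho_0(s)\,ds\quad(y\in\mathbb R).$$ (a) If $u_0$ is essentially bounded on $\{\rho_0\neq0\}$, then $F_{x,t}$ attains its minimum over $\mathbb R$ for all $x\in\mathbb R$, $t\ge0$. (b) Suppose that $F_{x,t}$ attains its minimum over $\mathbb R$ for all $x\in\mathbb R$, $t\ge0$. Let $y(x,t)\in(-\infty,+\infty]$ be the supremum of the set of minimizers of $F_{x,t}$, and let $$\mathcal M(x,t)=\int_0^{y(x,t)}\rho_0(s)\,ds,\qquad \mathcal P(x,t)=\int_0^{y(x,t)}\bigl(u_0(s)+\kappa E_0(s)t\bigr)\rho_0(s)\,ds .$$ Then there are finite positive Borel measures $\rho(\cdot,t)$ on $\mathbb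 R$, depending measurably on $t$, and a jointly measurable function $u(x,t)$ such that, for every $t\ge0$, in the sense of distributions on $\mathbb R$, $$\rho(\cdot,t)=\partial_x\mathcal M(\cdot,t),\qquad \rho u(\cdot,t)=\partial_x\mathcal P(\cdot,t)$$ (in particular $\partial_x\mathcal P(\cdot,t)$ is a signed Radon measure with density $u(\cdot,t)$ with respect to $\rho(\cdot,t)$), and $(\rho,\rho u)$ is a global weak solution of the pressureless Euler–Poisson system $$\rho_t+(\rho u)_x=0,\qquad(\rho u)_t+(\rho u^2)_x=\kappa\rho E,\qquad E_x=\rho,\quad E(-\infty,t)=0$$ with initial data $\rho_0$ and $\rho_0u_0$. Here $E(x,t)=\frac12\bigl(\rho((-\infty,x),t)+\rho((-\infty,x],t)\bigr)$, and weak solution means the following. For every $t\ge0$, $E_x(\cdot,t)=\rho(\cdot,t)$ in the sense of distributions and $E(x,t)\to0$ as $x\to-\infty$. The integral of $1+u^2+|E|$ against $\rho(dx,t)\,dt$ is finite on every compact subset of $[0,\infty)\times\mathbb R$. For all $\phi\in C_c^\infty([0,\infty)\times\mathbb R)$, written $\phi(t,x)$, $$\int_0^\infty\!\!\int_{\mathbb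 R}(\phi_t+u\phi_x)\,\rho(dx,t)\,dt+\int_{\mathbb R}\phi(0,x)\rho_0(x)\,dx=0,$$ $$\int_0^\infty\!\!\int_{\mathbb R}(u\phi_t+u^2\phi_x+\kappa E\phi)\,\rho(dx,t)\,dt+\int_{\mathbb R}\phi(0,x)\rho_0(x)u_0(x)\,dx=0 .$$ -/

import Mathlib

open MeasureTheory Set Filter Topology
open scoped ContDiff

noncomputable section

namespace EulerPoisson

/-- The initial electric field `E₀(s) = ∫_{-∞}^s ρ₀`. -/
def E0 (ρ0 : ℝ → ℝ) (s : ℝ) : ℝ := ∫ w in Iic s, ρ0 w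

/-- The quadratic form `Q_{x,t}(s) = s + t u₀(s) + ½ κ E₀(s) t² - x`. -/
def Q (κ : ℝ) (u0 ρ0 : ℝ → ℝ) (x t s : ℝ) : ℝ :=
  s + t * u0 s + 1 / 2 * κ * E0 ρ0 s * t ^ 2 - x

/-- The functional `y ↦ ∫_0^y Q_{x,t}(s) ρ₀(s) ds` that is minimized. -/
def objective (κ : ℝ) (u0 ρ0 : ℝ → ℝ) (x t y : ℝ) : ℝ :=
  ∫ s in (0 : ℝ)..y, Q κ u0 ρ0 x t s * ρ0 s

/-- The set of real numbers at which the functional attains its minimum over `ℝ`. -/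
def minimizers (κ : ℝ) (u0 ρ0 : ℝ → ℝ) (x t : ℝ) : Set ℝ :=
  {y | ∀ z, objective κ u0 ρ0 x t y ≤ objective κ u0 ρ0 x t z}

/-- `y(x,t)`, the supremum of the minimizers. It is taken in the extended reals, because the
minimizers fill a half line `[b, ∞)` when `ρ₀` vanishes on `[b, ∞)` and `x` is large. -/
def yMax (κ : ℝ) (u0 ρ0 : ℝ → ℝ) (x t : ℝ) : EReal :=
  sSup ((fun y : ℝ => (y : EReal)) '' minimizers κ u0 ρ0 x t)

/-- The oriented integral `∫_0^Y g(s) ds` with an extended real endpoint `Y`. -/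
def integralTo (g : ℝ → ℝ) (Y : EReal) : ℝ :=
  (∫ s in {s : ℝ | 0 < s ∧ (s : EReal) ≤ Y}, g s) -
    ∫ s in {s : ℝ | Y < (s : EReal) ∧ s ≤ 0}, g s

theorem integralTo_coe (g : ℝ → ℝ) (y : ℝ) :
    integralTo g (y : EReal) = ∫ s in (0 : ℝ)..y, g s := by
  simp only [integralTo, EReal.coe_le_coe_iff, EReal.coe_lt_coe_iff, intervalIntegral]
  rfl

/-- `ℳ(x,t) = ∫_0^{y(x,t)} ρ₀(s) ds`. -/
def mass (κ : ℝ) (u0 ρ0 : ℝ → ℝ) (t x : ℝ) : ℝ :=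
  integralTo ρ0 (yMax κ u0 ρ0 x t)

/-- `𝒫(x,t) = ∫_0^{y(x,t)} (u₀(s) + κ E₀(s) t) ρ₀(s) ds`. -/
def momentum (κ : ℝ) (u0 ρ0 : ℝ → ℝ) (t x : ℝ) : ℝ :=
  integralTo (fun s => (u0 s + κ * E0 ρ0 s * t) * ρ0 s) (yMax κ u0 ρ0 x t)

/-- The distributional derivative of `f` on `ℝ` is the (signed Radon) measure `g μ`. -/
def HasDistribDeriv (f : ℝ → ℝ) (μ : Measure ℝ) (g : ℝ → ℝ) : Prop :=
  LocallyIntegrable f volume ∧ LocallyIntegrable g μ ∧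
    ∀ φ : ℝ → ℝ, ContDiff ℝ ∞ φ → HasCompactSupport φ →
      ∫ x, f x * deriv φ x = - ∫ x, φ x * g x ∂μ

/-- The electric field of a mass distribution: an atom contributes one half of its mass at its
own location, `E(x) = ½ (μ((-∞, x)) + μ((-∞, x]))`. -/
def electricField (μ : Measure ℝ) (x : ℝ) : ℝ :=
  (μ.real (Iio x) + μ.real (Iic x)) / 2

/-- `(ρ, ρu)` is a global weak solution of
`ρ_t + (ρu)_x = 0`, `(ρu)_t + (ρu²)_x = κρE`, `E_x = ρ`, `E(-∞,t) = 0`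
on `[0,∞) × ℝ` with initial data `(ρ₀, ρ₀u₀)`. The density at time `t` is the measure `ρ t`, the
velocity is a function `u t` defined `ρ t`-almost everywhere, and the test functions are smooth
and compactly supported in `[0,∞) × ℝ` (that is, restrictions of such functions on `ℝ × ℝ`), so
that they see the initial data. -/
structure IsWeakSolution (κ : ℝ) (u0 ρ0 : ℝ → ℝ) (ρ : ℝ → Measure ℝ) (u : ℝ → ℝ → ℝ) :
    Prop where
  finite : ∀ t, IsFiniteMeasure (ρ t)
  measurable_density : Measurable ρ
  measurable_velocity : Measurable (Function.uncurry u)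
  /-- All terms of the weak formulation are absolutely integrable on compact sets. -/
  locally_integrable : ∀ T R : ℝ,
    ∫⁻ t in Icc 0 T, ∫⁻ x in Icc (-R) R,
      ENNReal.ofReal (1 + u t x ^ 2 + |electricField (ρ t) x|) ∂(ρ t) < ⊤
  field_deriv : ∀ t, 0 ≤ t → HasDistribDeriv (electricField (ρ t)) (ρ t) (fun _ => 1)
  field_atBot : ∀ t, 0 ≤ t → Tendsto (electricField (ρ t)) atBot (𝓝 0)
  mass_eq : ∀ φ : ℝ → ℝ → ℝ, ContDiff ℝ ∞ (Function.uncurry φ) →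
    HasCompactSupport (Function.uncurry φ) →
    (∫ t in Ioi (0 : ℝ), ∫ x, (deriv (fun s => φ s x) t + u t x * deriv (φ t) x) ∂(ρ t)) +
      ∫ x, φ 0 x * ρ0 x = 0
  momentum_eq : ∀ φ : ℝ → ℝ → ℝ, ContDiff ℝ ∞ (Function.uncurry φ) →
    HasCompactSupport (Function.uncurry φ) →
    (∫ t in Ioi (0 : ℝ), ∫ x, (u t x * deriv (fun s => φ s x) t + u t x ^ 2 * deriv (φ t) x +
        κ * electricField (ρ t) x * φ t x) ∂(ρ t)) +
      ∫ x, φ 0 x * (ρ0 x * u0 x) = 0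

end EulerPoisson

end

/-! Without collisions, the particle with label `s` follows the parabola `pos t s` with velocity
`vel t s`, and the functional is the integral of `pos t s - x` against the initial mass. Its
minimizers mark the labels that separate the mass to the left of `x` from the mass to the right.
Their mass increases with `x` (`IsMin.mass_le`), so inverting in `x` gives an order-preserving map
`flow t`. The solution is the image of the initial mass under `flow t`; its velocity is the average
of `vel t` over the labels at a given position.

Three facts carry the proof.

Localization (`exists_mass_mem_of_isMin`): solvability of the minimization problem at all points
confines the minimizers for `(x, t)` in a compact set to a fixed interval, up to intervals without
mass. This replaces every global bound on `u0`; it gives compactness of minimizers, local bounds on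
the velocity and Lipschitz paths.

Motion (`ae_hasDerivAt_flow`): the minimal value is Lipschitz along a path. When it and the path are
differentiable, all minimizers at the point give it the same derivative; comparing the two extremal
ones gives the Rankine-Hugoniot identity, so an atom moves with its average velocity. While a
particle is in no atom its label is a minimizer, hence a critical point, and the path is the free
parabola.

Averaging (`integral_velocity_mul`, `integral_electricField_mul`): against functions of position,
`vel` can be replaced by the velocity field. Likewise `mass` can be replaced by the electric field,
because the half-sign of `s - s'` among labels at the same place is antisymmetric.

The weak equations are then the fundamental theorem of calculus for `(α + t β) φ(t, flow t s)`,
integrated over labels, with `(α, β) = (1, 0)` and `(u0, κ mass)`. The formulas for the cumulative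
mass and momentum hold because `flow t s ≤ x` means, for almost every label, that `s` is at most the
largest minimizer.

For the existence statement, `Q` differs from the identity by a bounded amount where `ρ0 ≠ 0`, so
the functional can only grow outside a compact interval. -/

noncomputable section

namespace EulerPoisson

/-! ### Localization of the minimizers -/

section Localization

variable {A B C m : ℝ → ℝ} {c M : ℝ}

/-- The minimizer `y` is compared with a minimizer `y₀` at `(x₀ - 1, t₀)`: the unit shift in `x`
turns a mass deficit `ε` into a loss of at least `ε / 2`. The change of time contributes `(t - t₀) *
B y`, where `B` may be unbounded; solvability at the times `0` and `t₀ + 2` supplies the one-sided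
bounds on `B y` that are needed. -/
theorem eventually_le_of_isMin (hm : Monotone m) (hM : ∀ y, |m y| ≤ M) (hC : ∀ y, |C y| ≤ c)
    (hex : ∀ x t : ℝ, 0 ≤ t → ∃ y, ∀ z,
      A y + t * B y + t ^ 2 * C y - x * m y ≤ A z + t * B z + t ^ 2 * C z - x * m z)
    (x₀ t₀ : ℝ) (ht₀ : 0 ≤ t₀) :
    ∃ S, ∀ᶠ p : ℝ × ℝ in 𝓝 (x₀, t₀), 0 ≤ p.2 → ∀ y, (∀ z,
      A y + p.2 * B y + p.2 ^ 2 * C y - p.1 * m y ≤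
        A z + p.2 * B z + p.2 ^ 2 * C z - p.1 * m z) → ∀ s ≤ -S, m s ≤ m y := by
  obtain ⟨y₀, hy₀⟩ := hex (x₀ - 1) t₀ ht₀
  obtain ⟨z₀, hz₀⟩ := hex 0 0 le_rfl
  obtain ⟨z₁, hz₁⟩ := hex 0 (t₀ + 2) (by linarith)
  by_cases hS : ∃ S, m (-S) < m y₀
  swap
  -- Here `m y₀` is the smallest value of `m`, so every minimizer passes the test at `-S = y₀`.
  · push Not at hS
    refine ⟨-y₀, Eventually.of_forall fun p _ y _ s hs => ?_⟩
    have h1 := hS (-y)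
    rw [neg_neg] at h1 hs
    exact (hm hs).trans h1
  obtain ⟨S, hS⟩ := hS
  refine ⟨S, ?_⟩
  have hc0 : 0 ≤ c := (abs_nonneg _).trans (hC 0)
  have hM0 : 0 ≤ M := (abs_nonneg _).trans (hM 0)
  obtain ⟨ε, hε⟩ : ∃ ε, ε = m y₀ - m (-S) := ⟨_, rfl⟩
  have hε0 : 0 < ε := hε ▸ sub_pos.2 hS
  -- `k` bounds `A y + t * B y` (comparison of `y` with `0`), `k'` bounds `t * B y` (minimality of
  -- `z₀` at time `0`), and `-b` bounds `B y` from below (minimality of `z₁` at time `t₀ + 2`).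
  obtain ⟨k, hk⟩ : ∃ k, k = (|x₀| + 1) * (2 * M) + |A 0| + (t₀ + 1) * |B 0| +
    2 * ((t₀ + 2) ^ 2 * c) := ⟨_, rfl⟩
  obtain ⟨k', hk'⟩ : ∃ k', k' = k + |A z₀| := ⟨_, rfl⟩
  obtain ⟨b, hb⟩ : ∃ b, b = k + |A z₁| + (t₀ + 2) * |B z₁| + 2 * ((t₀ + 2) ^ 2 * c) := ⟨_, rfl⟩
  have hk0 : 0 ≤ k := by rw [hk]; positivity
  have hk'0 : 0 ≤ k' := by rw [hk']; positivity
  have hb0 : 0 ≤ b := by rw [hb]; positivity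
  obtain ⟨K, hK⟩ : ∃ K, K = |B y₀| + (2 * t₀ + 1) * (2 * c) + (b + k' * (2 / t₀)) := ⟨_, rfl⟩
  have e1 : ∀ᶠ p : ℝ × ℝ in 𝓝 (x₀, t₀), |p.1 - x₀| < 1 / 2 := by
    have : Tendsto (fun p : ℝ × ℝ => |p.1 - x₀|) (𝓝 (x₀, t₀)) (𝓝 |x₀ - x₀|) :=
      Continuous.tendsto (by fun_prop) (x₀, t₀)
    exact this.eventually_lt_const (by norm_num)
  have e2 : ∀ᶠ p : ℝ × ℝ in 𝓝 (x₀, t₀), |p.2 - t₀| < 1 := by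
    have : Tendsto (fun p : ℝ × ℝ => |p.2 - t₀|) (𝓝 (x₀, t₀)) (𝓝 |t₀ - t₀|) :=
      Continuous.tendsto (by fun_prop) (x₀, t₀)
    exact this.eventually_lt_const (by norm_num)
  have e3 : ∀ᶠ p : ℝ × ℝ in 𝓝 (x₀, t₀), |p.2 - t₀| * K < ε / 2 := by
    have : Tendsto (fun p : ℝ × ℝ => |p.2 - t₀| * K) (𝓝 (x₀, t₀)) (𝓝 (|t₀ - t₀| * K)) :=
      Continuous.tendsto (by fun_prop) (x₀, t₀)
    exact this.eventually_lt_const (by simpa using hε0)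
  have e4 : ∀ᶠ p : ℝ × ℝ in 𝓝 (x₀, t₀), 0 < t₀ → t₀ / 2 < p.2 := by
    by_cases h : 0 < t₀
    · have : Tendsto (fun p : ℝ × ℝ => p.2) (𝓝 (x₀, t₀)) (𝓝 t₀) :=
        Continuous.tendsto (by fun_prop) (x₀, t₀)
      filter_upwards [this.eventually_const_lt (half_lt_self h)] with p hp _ using hp
    · exact Eventually.of_forall fun p h' => absurd h' h
  filter_upwards [e1, e2, e3, e4] with ⟨x, t⟩ h1 h2 h3 h4 ht y hy s hs
  simp only at h1 h2 h3 h4 ht hy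
  refine (hm hs).trans ?_
  by_contra hlt
  push Not at hlt
  have hx : |x| ≤ |x₀| + 1 := by
    have := abs_sub_abs_le_abs_sub x x₀
    linarith
  have hsq : ∀ r, 0 ≤ r → r ≤ t₀ + 2 → ∀ y, |r ^ 2 * C y| ≤ (t₀ + 2) ^ 2 * c := by
    intro r hr hr' y
    rw [abs_mul, abs_of_nonneg (by positivity : 0 ≤ r ^ 2)]
    gcongr
    exact hC y
  have ht1 : t ≤ t₀ + 1 := by linarith [(abs_lt.1 h2).2]
  have key1 := hy 0
  have q1 := hsq t ht (by linarith) y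
  have q2 := hsq t ht (by linarith) 0
  have q3 : |x * (m y - m 0)| ≤ (|x₀| + 1) * (2 * M) := by
    rw [abs_mul]
    gcongr
    have := abs_sub (m y) (m 0)
    linarith [hM y, hM 0]
  have q4 : |t * B 0| ≤ (t₀ + 1) * |B 0| := by
    rw [abs_mul, abs_of_nonneg ht]
    gcongr
  have upper : A y + t * B y ≤ k := by
    have := abs_le.1 q1; have := abs_le.1 q2; have := abs_le.1 q3; have := abs_le.1 q4
    have := le_abs_self (A 0)
    linarith
  have key2 := hz₀ y
  have lowA : -|A z₀| ≤ A y := by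
    have := neg_abs_le (A z₀)
    simp only [zero_mul, zero_pow two_ne_zero, add_zero, sub_zero] at key2
    linarith
  have htB : t * B y ≤ k' := by linarith
  have key3 := hz₁ y
  have q5 := hsq (t₀ + 2) (by linarith) le_rfl y
  have q6 := hsq (t₀ + 2) (by linarith) le_rfl z₁
  have q7 : |(t₀ + 2) * B z₁| = (t₀ + 2) * |B z₁| := by
    rw [abs_mul, abs_of_nonneg (by linarith : 0 ≤ t₀ + 2)]
  have hBlow : -b ≤ (t₀ + 2 - t) * B y := by
    have := abs_le.1 q5; have := abs_le.1 q6; have := neg_abs_le (A z₁)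
    have := neg_abs_le ((t₀ + 2) * B z₁)
    linarith
  -- The time `t₀ + 2` exceeds `t` by at least `1`, so the factor can be dropped.
  have hBb : -b ≤ B y := by
    by_contra hneg
    push Not at hneg
    have : (t₀ + 2 - t) * B y ≤ 1 * B y := by
      apply mul_le_mul_of_nonpos_right <;> linarith
    linarith
  -- The sign of `t - t₀` decides which one-sided bound on `B y` is used. The upper bound is needed
  -- only for `t < t₀`; then `t₀ > 0` and `t > t₀ / 2`.
  have hdiff : -((t - t₀) * B y) ≤ |t - t₀| * (b + k' * (2 / t₀)) := by
    have hkt : 0 ≤ k' * (2 / t₀) := by positivity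
    rcases le_total t₀ t with h | h
    · rw [abs_of_nonneg (sub_nonneg.2 h)]
      have := mul_le_mul_of_nonneg_left (neg_le_neg hBb) (sub_nonneg.2 h)
      rw [neg_neg] at this
      linarith [mul_nonneg (sub_nonneg.2 h) hkt, mul_neg (t - t₀) (B y),
        mul_add (t - t₀) b (k' * (2 / t₀))]
    · rcases h.eq_or_lt with h | h
      · simp [h]
      have ht₀' : 0 < t₀ := by linarith
      have h5 := h4 ht₀'
      have hBu : B y ≤ k' * (2 / t₀) := by
        rw [mul_div_assoc', le_div_iff₀ ht₀']
        rcases le_total 0 (B y) with h0 | h0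
        · linarith [mul_le_mul_of_nonneg_right h5.le h0]
        · linarith [mul_nonpos_of_nonpos_of_nonneg h0 ht₀]
      rw [abs_of_nonpos (sub_nonpos.2 h.le)]
      have := mul_le_mul_of_nonneg_left hBu (sub_nonneg.2 h.le)
      have h7 := mul_nonneg (sub_nonneg.2 h.le) hb0
      linarith [mul_add (t₀ - t) b (k' * (2 / t₀))]
  have q8 : |(t ^ 2 - t₀ ^ 2) * (C y - C y₀)| ≤ |t - t₀| * ((2 * t₀ + 1) * (2 * c)) := by
    have : t ^ 2 - t₀ ^ 2 = (t - t₀) * (t + t₀) := by ring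
    rw [this, abs_mul, abs_mul, mul_assoc]
    gcongr
    · rw [abs_of_nonneg (by linarith)]; linarith
    · have := abs_sub (C y) (C y₀)
      linarith [hC y, hC y₀]
  have q9 : |(t - t₀) * B y₀| = |t - t₀| * |B y₀| := abs_mul _ _
  -- In the sum of these two inequalities `A` cancels, and only increments in time and space remain.
  have key4 := hy₀ y
  have key5 := hy y₀
  have h6 : (x - x₀ + 1) * (m y - m y₀) ≤ -(ε / 2) := by
    have h7 := (abs_lt.1 h1).1
    have h8 : m y - m y₀ ≤ -ε := by linarith
    have := mul_le_mul_of_nonneg_left h8 (by linarith : 0 ≤ x - x₀ + 1)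
    have := mul_le_mul_of_nonneg_right (by linarith : 1 / 2 ≤ x - x₀ + 1) hε0.le
    linarith
  have := abs_le.1 q8
  have := le_abs_self ((t - t₀) * B y₀)
  have : |t - t₀| * K = |t - t₀| * |B y₀| + |t - t₀| * ((2 * t₀ + 1) * (2 * c)) +
    |t - t₀| * (b + k' * (2 / t₀)) := by rw [hK]; ring
  linarith

theorem exists_le_of_isMin (hm : Monotone m) (hM : ∀ y, |m y| ≤ M) (hC : ∀ y, |C y| ≤ c)
    (hex : ∀ x t : ℝ, 0 ≤ t → ∃ y, ∀ z,
      A y + t * B y + t ^ 2 * C y - x * m y ≤ A z + t * B z + t ^ 2 * C z - x * m z)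
    (R T : ℝ) :
    ∃ S, ∀ x t : ℝ, |x| ≤ R → 0 ≤ t → t ≤ T → ∀ y, (∀ z,
      A y + t * B y + t ^ 2 * C y - x * m y ≤ A z + t * B z + t ^ 2 * C z - x * m z) →
        ∀ s ≤ -S, m s ≤ m y := by
  have hcomp : IsCompact (Icc (-R) R ×ˢ Icc 0 T) := isCompact_Icc.prod isCompact_Icc
  have : ∃ S, ∀ p ∈ Icc (-R) R ×ˢ Icc 0 T, 0 ≤ p.2 → ∀ y, (∀ z,
      A y + p.2 * B y + p.2 ^ 2 * C y - p.1 * m y ≤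
        A z + p.2 * B z + p.2 ^ 2 * C z - p.1 * m z) → ∀ s ≤ -S, m s ≤ m y := by
    refine hcomp.induction_on (p := fun K => ∃ S, ∀ p ∈ K, 0 ≤ p.2 → ∀ y, (∀ z,
      A y + p.2 * B y + p.2 ^ 2 * C y - p.1 * m y ≤
        A z + p.2 * B z + p.2 ^ 2 * C z - p.1 * m z) → ∀ s ≤ -S, m s ≤ m y) ?_ ?_ ?_ ?_
    · exact ⟨0, by simp⟩
    · rintro s t hst ⟨S, hS⟩
      exact ⟨S, fun p hp => hS p (hst hp)⟩
    · rintro s t ⟨S, hS⟩ ⟨S', hS'⟩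
      refine ⟨max S S', fun p hp h0 y hy r hr => ?_⟩
      have h1 := le_max_left S S'
      have h2 := le_max_right S S'
      rcases hp with hp | hp
      · exact hS p hp h0 y hy r (by linarith)
      · exact hS' p hp h0 y hy r (by linarith)
    · rintro ⟨x, t⟩ hp
      obtain ⟨S, hS⟩ := eventually_le_of_isMin hm hM hC hex x t hp.2.1
      exact ⟨_, mem_nhdsWithin_of_mem_nhds hS, S, fun p hp => hp⟩
  obtain ⟨S, hS⟩ := this
  exact ⟨S, fun x t hx h0 hT => hS (x, t) ⟨abs_le.1 hx, h0, hT⟩ h0⟩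

end Localization

end EulerPoisson

/-! ### The minimization problem for a finite measure without atoms -/

namespace EulerPoisson

/-- The data of the minimization problem, with the mass distribution given by a finite measure
without atoms. -/
structure InitialData where
  κ : ℝ
  u0 : ℝ → ℝ
  μ : Measure ℝ
  continuous_u0 : Continuous u0
  isFiniteMeasure : IsFiniteMeasure μ
  nullSingleton : NullSingletonClass μ
  exists_min : ∀ x t : ℝ, 0 ≤ t → ∃ y : ℝ, ∀ z : ℝ,
    ∫ s in (0 : ℝ)..y, (s + t * u0 s + 1 / 2 * κ * μ.real (Iic s) * t ^ 2 - x) ∂μ ≤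
      ∫ s in (0 : ℝ)..z, (s + t * u0 s + 1 / 2 * κ * μ.real (Iic s) * t ^ 2 - x) ∂μ

namespace InitialData

attribute [instance] isFiniteMeasure nullSingleton

variable (D : InitialData)

/-- The mass to the left of a point. -/
def mass (s : ℝ) : ℝ := D.μ.real (Iic s)

/-- The total mass. -/
def total : ℝ := D.μ.real univ

/-- The position at time `t` of the freely moving particle with label `s`. -/
def pos (t s : ℝ) : ℝ := s + t * D.u0 s + 1 / 2 * D.κ * D.mass s * t ^ 2

/-- The velocity at time `t` of the freely moving particle with label `s`. -/
def vel (t s : ℝ) : ℝ := D.u0 s + D.κ * D.mass s * t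

/-- The functional that is minimized. -/
def cost (x t y : ℝ) : ℝ := ∫ s in (0 : ℝ)..y, (D.pos t s - x) ∂D.μ

/-- `y` is a minimizer of the functional at `(x, t)`. -/
def IsMin (x t y : ℝ) : Prop := ∀ z, D.cost x t y ≤ D.cost x t z

theorem exists_isMin (x : ℝ) {t : ℝ} (ht : 0 ≤ t) : ∃ y, D.IsMin x t y := D.exists_min x t ht

theorem mass_mono : Monotone D.mass := fun _ _ h => measureReal_mono (Iic_subset_Iic.2 h)

theorem mass_nonneg (s : ℝ) : 0 ≤ D.mass s := measureReal_nonneg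

theorem mass_le_total (s : ℝ) : D.mass s ≤ D.total := measureReal_mono (subset_univ _)

theorem total_nonneg : 0 ≤ D.total := measureReal_nonneg

theorem abs_mass_le (s : ℝ) : |D.mass s| ≤ D.total := by
  rw [abs_of_nonneg (D.mass_nonneg s)]
  exact D.mass_le_total s

theorem mass_sub_mass (a b : ℝ) : D.mass b - D.mass a = ∫ _ in a..b, (1 : ℝ) ∂D.μ := by
  rw [← intervalIntegral.integral_Iic_sub_Iic (integrable_const _) (integrable_const _)]
  simp [mass]

theorem measureReal_Ioc {a b : ℝ} (h : a ≤ b) : D.μ.real (Ioc a b) = D.mass b - D.mass a := by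
  rw [mass_sub_mass, intervalIntegral.integral_of_le h]
  simp

theorem continuous_mass : Continuous D.mass := by
  have h : D.mass = fun b => D.mass 0 + ∫ _ in (0 : ℝ)..b, (1 : ℝ) ∂D.μ := by
    funext b
    rw [← mass_sub_mass]
    ring
  rw [h]
  exact continuous_const.add
    (intervalIntegral.continuous_primitive (fun a b => intervalIntegrable_const) 0)

theorem tendsto_mass_atTop : Tendsto D.mass atTop (𝓝 D.total) :=
  (ENNReal.tendsto_toReal (measure_ne_top _ _)).comp (tendsto_measure_Iic_atTop D.μ)

theorem tendsto_mass_atBot : Tendsto D.mass atBot (𝓝 0) := by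
  have h : Tendsto (fun s => D.total - D.μ.real (Ici s)) atBot (𝓝 0) := by
    have h1 := (ENNReal.tendsto_toReal (measure_ne_top D.μ univ)).comp
      (tendsto_measure_Ici_atBot D.μ)
    simpa [total, Measure.real] using tendsto_const_nhds (x := D.total).sub h1
  refine h.congr fun s => ?_
  have := measureReal_compl (μ := D.μ) (measurableSet_Ici (a := s))
  rw [compl_Ici, measureReal_congr Iio_ae_eq_Iic] at this
  exact this.symm

theorem continuous_pos : Continuous (Function.uncurry D.pos) := by
  have h1 := D.continuous_u0
  have h2 := D.continuous_mass
  unfold pos Function.uncurry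
  fun_prop

theorem continuous_vel : Continuous (Function.uncurry D.vel) := by
  have h1 := D.continuous_u0
  have h2 := D.continuous_mass
  unfold vel Function.uncurry
  fun_prop

theorem continuous_pos_right (t : ℝ) : Continuous (D.pos t) :=
  D.continuous_pos.comp (Continuous.prodMk_right t)

theorem continuous_vel_right (t : ℝ) : Continuous (D.vel t) :=
  D.continuous_vel.comp (Continuous.prodMk_right t)

theorem cost_sub_cost (x t y z : ℝ) :
    D.cost x t z - D.cost x t y = ∫ s in y..z, (D.pos t s - x) ∂D.μ := by
  have h : Continuous fun s => D.pos t s - x := (D.continuous_pos_right t).sub continuous_const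
  exact intervalIntegral.integral_interval_sub_left (h.intervalIntegrable _ _)
    (h.intervalIntegrable _ _)

/-- The part of the functional that does not depend on time. -/
def costA (y : ℝ) : ℝ := ∫ s in (0 : ℝ)..y, s ∂D.μ

/-- The part of the functional that is linear in time. -/
def costB (y : ℝ) : ℝ := ∫ s in (0 : ℝ)..y, D.u0 s ∂D.μ

/-- The part of the functional that is quadratic in time. -/
def costC (y : ℝ) : ℝ := ∫ s in (0 : ℝ)..y, 1 / 2 * D.κ * D.mass s ∂D.μ

theorem cost_eq (x t y : ℝ) : D.cost x t y =
    D.costA y + t * D.costB y + t ^ 2 * D.costC y - x * D.mass y + x * D.mass 0 := by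
  have h1 := D.continuous_u0
  have h2 := D.continuous_mass
  have e : x * D.mass y - x * D.mass 0 = ∫ _ in (0 : ℝ)..y, x * (1 : ℝ) ∂D.μ := by
    rw [intervalIntegral.integral_const_mul, ← mass_sub_mass]
    ring
  rw [costA, costB, costC, ← intervalIntegral.integral_const_mul,
    ← intervalIntegral.integral_const_mul, sub_add, e, ← intervalIntegral.integral_add,
    ← intervalIntegral.integral_add, ← intervalIntegral.integral_sub, cost]
  · congr 1
    funext s
    simp only [pos]
    ring
  all_goals
    apply Continuous.intervalIntegrable
    fun_prop

theorem continuous_costA : Continuous D.costA :=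
  intervalIntegral.continuous_primitive (fun _ _ => continuous_id.intervalIntegrable _ _) 0

theorem continuous_costB : Continuous D.costB :=
  intervalIntegral.continuous_primitive (fun _ _ => D.continuous_u0.intervalIntegrable _ _) 0

theorem continuous_costC : Continuous D.costC :=
  intervalIntegral.continuous_primitive
    (fun _ _ => (continuous_const.mul D.continuous_mass).intervalIntegrable _ _) 0

theorem continuous_cost : Continuous fun p : ℝ × ℝ × ℝ => D.cost p.1 p.2.1 p.2.2 := by
  have h1 := D.continuous_costA
  have h2 := D.continuous_costB
  have h3 := D.continuous_costC
  have h4 := D.continuous_mass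
  simp only [cost_eq]
  fun_prop

theorem isMin_iff {x t y : ℝ} : D.IsMin x t y ↔ ∀ z,
    D.costA y + t * D.costB y + t ^ 2 * D.costC y - x * D.mass y ≤
      D.costA z + t * D.costB z + t ^ 2 * D.costC z - x * D.mass z := by
  simp only [IsMin, cost_eq, add_le_add_iff_right]

theorem integral_eq_zero_of_mass_eq {y z : ℝ} (h : D.mass y = D.mass z) (f : ℝ → ℝ) :
    ∫ s in y..z, f s ∂D.μ = 0 := by
  have key : ∀ {a b : ℝ}, a ≤ b → D.mass a = D.mass b → ∫ s in a..b, f s ∂D.μ = 0 := by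
    intro a b hab hm
    have := D.measureReal_Ioc hab
    rw [hm, sub_self, measureReal_eq_zero_iff] at this
    rw [intervalIntegral.integral_of_le hab, Measure.restrict_eq_zero.2 this,
      integral_zero_measure]
  rcases le_total y z with hyz | hyz
  · exact key hyz h
  · rw [intervalIntegral.integral_symm, key hyz h.symm, neg_zero]

theorem cost_eq_of_mass_eq {y z : ℝ} (h : D.mass y = D.mass z) (x t : ℝ) :
    D.cost x t y = D.cost x t z := by
  have := D.cost_sub_cost x t y z
  rw [D.integral_eq_zero_of_mass_eq h] at this
  linarith

variable {D}

theorem IsMin.of_mass_eq {x t y z : ℝ} (h : D.IsMin x t y) (hm : D.mass y = D.mass z) :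
    D.IsMin x t z := fun w => D.cost_eq_of_mass_eq hm x t ▸ h w

/-- Adding the two minimality inequalities leaves `(x' - x) * (mass y' - mass y) ≥ 0`. This is the
source of the ordering of particles. -/
theorem IsMin.mass_le {x x' t y y' : ℝ} (h : D.IsMin x t y) (h' : D.IsMin x' t y')
    (hx : x < x') : D.mass y ≤ D.mass y' := by
  have h1 := D.isMin_iff.1 h y'
  have h2 := D.isMin_iff.1 h' y
  have h3 : 0 ≤ (x' - x) * (D.mass y' - D.mass y) := by linarith
  exact sub_nonneg.1 (nonneg_of_mul_nonneg_right h3 (sub_pos.2 hx))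

variable (D)

theorem abs_costC_le (y : ℝ) : |D.costC y| ≤ |D.κ| * D.total * D.total := by
  have := intervalIntegral.norm_integral_le_abs_of_norm_le (μ := D.μ) (a := 0) (b := y)
    (f := fun s => 1 / 2 * D.κ * D.mass s) (g := fun _ => |D.κ| * D.total)
    (Eventually.of_forall fun s => ?_) intervalIntegrable_const
  · rw [← Real.norm_eq_abs, costC]
    refine this.trans ?_
    have e : ∫ _ in (0 : ℝ)..y, |D.κ| * D.total ∂D.μ = |D.κ| * D.total * (D.mass y - D.mass 0) := by
      rw [mass_sub_mass, ← intervalIntegral.integral_const_mul]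
      simp
    rw [e, abs_mul, abs_of_nonneg (mul_nonneg (abs_nonneg _) D.total_nonneg)]
    refine mul_le_mul_of_nonneg_left ?_ (mul_nonneg (abs_nonneg _) D.total_nonneg)
    rw [abs_le]
    constructor <;> linarith [D.mass_nonneg y, D.mass_nonneg 0, D.mass_le_total y,
      D.mass_le_total 0]
  · rw [Real.norm_eq_abs, abs_mul, abs_mul]
    have := D.abs_mass_le s
    have h2 : |(1 / 2 : ℝ)| = 1 / 2 := by norm_num
    rw [h2]
    have := mul_le_mul_of_nonneg_left this (abs_nonneg D.κ)
    have := mul_nonneg (abs_nonneg D.κ) (abs_nonneg (D.mass s))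
    nlinarith

theorem exists_mass_mem_of_isMin (R T : ℝ) : ∃ S, 0 ≤ S ∧ ∀ x t y : ℝ, |x| ≤ R → 0 ≤ t → t ≤ T →
    D.IsMin x t y → D.mass (-S) ≤ D.mass y ∧ D.mass y ≤ D.mass S := by
  obtain ⟨S₁, h₁⟩ := exists_le_of_isMin D.mass_mono D.abs_mass_le D.abs_costC_le
    (fun x t ht => (D.exists_isMin x ht).imp fun _ h => D.isMin_iff.1 h) R T
  -- The reflection `y ↦ -y`, `x ↦ -x` preserves the form of the problem, so the lower bound for the
  -- reflected data is the upper bound.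
  obtain ⟨S₂, h₂⟩ := exists_le_of_isMin (A := fun y => D.costA (-y)) (B := fun y => D.costB (-y))
    (C := fun y => D.costC (-y)) (m := fun y => -D.mass (-y))
    (fun a b h => neg_le_neg (D.mass_mono (neg_le_neg h)))
    (fun y => (abs_neg _).trans_le (D.abs_mass_le _)) (fun y => D.abs_costC_le _)
    (fun x t ht => by
      obtain ⟨y, hy⟩ := D.exists_isMin (-x) ht
      refine ⟨-y, fun z => ?_⟩
      have := D.isMin_iff.1 hy (-z)
      rw [neg_neg]
      linarith) R T
  have l1 := le_max_left S₁ S₂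
  have l2 := le_max_right S₁ S₂
  have l3 := le_max_left (max S₁ S₂) 0
  have l4 := le_max_right (max S₁ S₂) 0
  refine ⟨max (max S₁ S₂) 0, l4, fun x t y hx h0 hT hy => ⟨?_, ?_⟩⟩
  · exact h₁ x t hx h0 hT y (D.isMin_iff.1 hy) _ (by linarith)
  · have := h₂ (-x) t (by rwa [abs_neg]) h0 hT (-y) (fun z => ?_) (-max (max S₁ S₂) 0)
      (by linarith)
    · simpa using this
    · have := D.isMin_iff.1 hy (-z)
      rw [neg_neg]
      linarith

/-- A minimizer outside the interval is separated from the nearer endpoint by no mass, so the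
endpoint is a minimizer too. -/
theorem exists_mem_Icc_of_isMin (R T : ℝ) : ∃ S, 0 ≤ S ∧ ∀ x t y : ℝ, |x| ≤ R → 0 ≤ t → t ≤ T →
    D.IsMin x t y → ∃ z ∈ Icc (-S) S, D.mass z = D.mass y ∧ D.IsMin x t z := by
  obtain ⟨S, hS, h⟩ := D.exists_mass_mem_of_isMin R T
  refine ⟨S, hS, fun x t y hx h0 hT hy => ?_⟩
  obtain ⟨h1, h2⟩ := h x t y hx h0 hT hy
  have key : ∃ z ∈ Icc (-S) S, D.mass z = D.mass y := by
    rcases lt_or_ge y (-S) with h3 | h3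
    · exact ⟨-S, by constructor <;> linarith, h1.antisymm (D.mass_mono h3.le)⟩
    rcases lt_or_ge S y with h4 | h4
    · exact ⟨S, by constructor <;> linarith, (D.mass_mono h4.le).antisymm h2⟩
    · exact ⟨y, ⟨h3, h4⟩, rfl⟩
  obtain ⟨z, hz, hzy⟩ := key
  exact ⟨z, hz, hzy, hy.of_mass_eq hzy.symm⟩

theorem isClosed_isMin : IsClosed {p : ℝ × ℝ × ℝ | D.IsMin p.1 p.2.1 p.2.2} := by
  have : {p : ℝ × ℝ × ℝ | D.IsMin p.1 p.2.1 p.2.2} =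
      ⋂ z, {p : ℝ × ℝ × ℝ | D.cost p.1 p.2.1 p.2.2 ≤ D.cost p.1 p.2.1 z} := by
    ext p
    simp [IsMin]
  rw [this]
  refine isClosed_iInter fun z => isClosed_le D.continuous_cost ?_
  exact D.continuous_cost.comp (by fun_prop : Continuous fun p : ℝ × ℝ × ℝ => (p.1, p.2.1, z))

/-- Limits of minimizers are minimizers, up to intervals without mass. -/
theorem exists_isMin_of_tendsto {t : ℝ} (ht : 0 ≤ t) {x : ℕ → ℝ} {y : ℕ → ℝ} {x' : ℝ}
    (hx : Tendsto x atTop (𝓝 x')) (hy : ∀ n, D.IsMin (x n) t (y n)) :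
    ∃ y', D.IsMin x' t y' ∧ ∃ φ : ℕ → ℕ,
      Tendsto (fun n => D.mass (y (φ n))) atTop (𝓝 (D.mass y')) := by
  obtain ⟨R, hR⟩ := (Metric.isBounded_range_of_tendsto x hx).exists_norm_le
  obtain ⟨S, _, hS⟩ := D.exists_mem_Icc_of_isMin R t
  choose z hz hzm hzmin using fun n => hS (x n) t (y n) (hR _ (mem_range_self n)) ht le_rfl (hy n)
  obtain ⟨y', _, φ, hφ, hlim⟩ := isCompact_Icc.tendsto_subseq hz
  refine ⟨y', ?_, φ, ?_⟩
  · have hl : Tendsto (fun n => (x (φ n), t, z (φ n))) atTop (𝓝 (x', t, y')) :=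
      (hx.comp hφ.tendsto_atTop).prodMk_nhds (tendsto_const_nhds.prodMk_nhds hlim)
    exact D.isClosed_isMin.mem_of_tendsto hl (Eventually.of_forall fun n => hzmin (φ n))
  · simp only [← hzm]
    exact (D.continuous_mass.tendsto y').comp hlim

/-- "Greatest" refers to mass: the labels of minimizers may be unbounded, but their masses are all
attained on a compact set. -/
theorem exists_greatest_isMin (x : ℝ) {t : ℝ} (ht : 0 ≤ t) :
    ∃ b, D.IsMin x t b ∧ ∀ y, D.IsMin x t y → D.mass y ≤ D.mass b := by
  obtain ⟨S, _, hS⟩ := D.exists_mem_Icc_of_isMin |x| t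
  have hcl : IsClosed {y | D.IsMin x t y} :=
    D.isClosed_isMin.preimage (by fun_prop : Continuous fun y : ℝ => (x, t, y))
  obtain ⟨y₀, hy₀⟩ := D.exists_isMin x ht
  obtain ⟨z₀, hz₀, -, hz₀'⟩ := hS x t y₀ le_rfl ht le_rfl hy₀
  obtain ⟨b, hb, hmax⟩ := (isCompact_Icc.inter_right hcl).exists_isMaxOn ⟨z₀, hz₀, hz₀'⟩
    D.continuous_mass.continuousOn
  refine ⟨b, hb.2, fun y hy => ?_⟩
  obtain ⟨z, hz, hzm, hz'⟩ := hS x t y le_rfl ht le_rfl hy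
  exact hzm ▸ hmax ⟨hz, hz'⟩

theorem exists_least_isMin (x : ℝ) {t : ℝ} (ht : 0 ≤ t) :
    ∃ a, D.IsMin x t a ∧ ∀ y, D.IsMin x t y → D.mass a ≤ D.mass y := by
  obtain ⟨S, _, hS⟩ := D.exists_mem_Icc_of_isMin |x| t
  have hcl : IsClosed {y | D.IsMin x t y} :=
    D.isClosed_isMin.preimage (by fun_prop : Continuous fun y : ℝ => (x, t, y))
  obtain ⟨y₀, hy₀⟩ := D.exists_isMin x ht
  obtain ⟨z₀, hz₀, -, hz₀'⟩ := hS x t y₀ le_rfl ht le_rfl hy₀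
  obtain ⟨b, hb, hmin⟩ := (isCompact_Icc.inter_right hcl).exists_isMinOn ⟨z₀, hz₀, hz₀'⟩
    D.continuous_mass.continuousOn
  refine ⟨b, hb.2, fun y hy => ?_⟩
  obtain ⟨z, hz, hzm, hz'⟩ := hS x t y le_rfl ht le_rfl hy
  exact hzm ▸ hmin ⟨hz, hz'⟩

end InitialData
end EulerPoisson

namespace EulerPoisson
namespace InitialData

variable (D : InitialData)

/-! ### The flow map -/

/-- The label `s` has positive mass on both sides. -/
def Interior (s : ℝ) : Prop := 0 < D.mass s ∧ D.mass s < D.total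

/-- The label `s` is not in the closure of an interval without mass. -/
def Generic (s : ℝ) : Prop := ∀ b, b ≠ s → D.mass b ≠ D.mass s

open Classical in
/-- The position at time `t` of the particle with label `s`. -/
def flow (t s : ℝ) : ℝ :=
  if D.Interior s then sInf {x | ∃ y, D.IsMin x (max t 0) y ∧ D.mass s ≤ D.mass y} else 0

/-- By inner regularity it suffices to treat a compact subset; it lies between two points of equal
mass, hence in a null interval. -/
theorem measure_mass_eq (r : ℝ) : D.μ {s | D.mass s = r} = 0 := by
  have hmeas : MeasurableSet {s | D.mass s = r} :=
    D.continuous_mass.measurable (measurableSet_singleton r)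
  by_contra hne
  obtain ⟨K, hK, hKc, hpos⟩ := hmeas.exists_lt_isCompact (pos_iff_ne_zero.2 hne)
  have hKn : K.Nonempty := by
    by_contra h
    rw [not_nonempty_iff_eq_empty.1 h] at hpos
    simp at hpos
  have ha := hKc.sInf_mem hKn
  have hb := hKc.sSup_mem hKn
  have hsub : K ⊆ Icc (sInf K) (sSup K) := fun x hx =>
    ⟨csInf_le hKc.bddBelow hx, le_csSup hKc.bddAbove hx⟩
  have hle : sInf K ≤ sSup K := (hsub hb).1
  have := D.measureReal_Ioc hle
  have hab : D.mass (sSup K) = D.mass (sInf K) := (hK hb).trans (hK ha).symm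
  rw [hab, sub_self, measureReal_eq_zero_iff, measure_congr Ioc_ae_eq_Icc] at this
  exact hpos.ne' (measure_mono_null hsub this)

theorem ae_interior : ∀ᵐ s ∂D.μ, D.Interior s := by
  have h1 : ∀ᵐ s ∂D.μ, D.mass s ≠ 0 := by
    rw [ae_iff]; simpa using D.measure_mass_eq 0
  have h2 : ∀ᵐ s ∂D.μ, D.mass s ≠ D.total := by
    rw [ae_iff]; simpa using D.measure_mass_eq D.total
  filter_upwards [h1, h2] with s hs1 hs2
  exact ⟨(D.mass_nonneg s).lt_of_ne hs1.symm, (D.mass_le_total s).lt_of_ne hs2⟩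

/-- An interval without mass at `s` contains a rational of the same mass as `s`, and countably many
level sets of `mass` are null. -/
theorem ae_generic : ∀ᵐ s ∂D.μ, D.Generic s := by
  have h : ∀ᵐ s ∂D.μ, ∀ q : ℚ, D.mass s ≠ D.mass q := by
    rw [ae_all_iff]
    intro q
    rw [ae_iff]
    simpa using D.measure_mass_eq (D.mass q)
  filter_upwards [h] with s hs b hb hbs
  rcases lt_or_gt_of_ne hb with hlt | hlt
  · obtain ⟨q, h1, h2⟩ := exists_rat_btwn hlt
    refine hs q (le_antisymm ?_ ?_)
    · rw [← hbs]; exact D.mass_mono h1.le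
    · exact D.mass_mono h2.le
  · obtain ⟨q, h1, h2⟩ := exists_rat_btwn hlt
    refine hs q (le_antisymm (D.mass_mono h1.le) ?_)
    rw [← hbs]; exact D.mass_mono h2.le

variable {D}

theorem Generic.mass_lt_iff {s : ℝ} (h : D.Generic s) {b : ℝ} : D.mass b < D.mass s ↔ b < s := by
  refine ⟨fun hb => D.mass_mono.reflect_lt hb, fun hb => ?_⟩
  exact (D.mass_mono hb.le).lt_of_ne (h b hb.ne)

theorem Generic.lt_mass_iff {s : ℝ} (h : D.Generic s) {b : ℝ} : D.mass s < D.mass b ↔ s < b := by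
  refine ⟨fun hb => D.mass_mono.reflect_lt hb, fun hb => ?_⟩
  exact (D.mass_mono hb.le).lt_of_ne (h b hb.ne').symm

theorem Generic.mass_le_iff {s : ℝ} (h : D.Generic s) {b : ℝ} : D.mass s ≤ D.mass b ↔ s ≤ b := by
  rw [← not_lt, ← not_lt, h.mass_lt_iff]

variable (D)

theorem exists_abs_cost_le (S T : ℝ) : ∃ K, 0 ≤ K ∧ ∀ t y : ℝ, 0 ≤ t → t ≤ T → y ∈ Icc (-S) S →
    |D.cost 0 t y| ≤ K := by
  have hc : Continuous fun p : ℝ × ℝ => D.cost 0 p.1 p.2 :=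
    D.continuous_cost.comp (by fun_prop : Continuous fun p : ℝ × ℝ => ((0 : ℝ), p.1, p.2))
  obtain ⟨K, hK⟩ := (isCompact_Icc.prod isCompact_Icc :
    IsCompact (Icc 0 T ×ˢ Icc (-S) S)).exists_bound_of_continuousOn hc.continuousOn
  exact ⟨max K 0, le_max_right _ _, fun t y h0 hT hy =>
    (hK (t, y) ⟨⟨h0, hT⟩, hy⟩).trans (le_max_left _ _)⟩

theorem exists_neg_le_cost (T : ℝ) :
    ∃ K, 0 ≤ K ∧ ∀ t y : ℝ, 0 ≤ t → t ≤ T → -K ≤ D.cost 0 t y := by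
  obtain ⟨S, _, hS⟩ := D.exists_mem_Icc_of_isMin 0 T
  obtain ⟨K, hK0, hK⟩ := D.exists_abs_cost_le S T
  refine ⟨K, hK0, fun t y h0 hT => ?_⟩
  obtain ⟨y₀, hy₀⟩ := D.exists_isMin 0 h0
  obtain ⟨z, hz, -, hmin⟩ := hS 0 t y₀ (by simp) h0 hT hy₀
  linarith [hmin y, (abs_le.1 (hK t z h0 hT hz)).1]

variable {D}

/-- An interior label has mass at least `δ` to spare on both sides. For a minimizer on the wrong
side of `s`, moving to `z₁` or `z₂` gains at least `|x| * δ` and costs at most `K + K'`, which is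
impossible once `|x| > (K + K') / δ`. -/
theorem Interior.exists_bound {s : ℝ} (hs : D.Interior s) (T : ℝ) :
    ∃ R, 0 ≤ R ∧ ∀ t x y : ℝ, 0 ≤ t → t ≤ T → D.IsMin x t y →
      (R < x → D.mass s < D.mass y) ∧ (x < -R → D.mass y < D.mass s) := by
  obtain ⟨K, hK0, hK⟩ := D.exists_neg_le_cost T
  obtain ⟨z₁, hz₁⟩ := ((D.tendsto_mass_atTop.eventually_const_lt hs.2)).exists
  obtain ⟨z₂, hz₂⟩ := ((D.tendsto_mass_atBot.eventually_lt_const hs.1)).exists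
  obtain ⟨K', hK'0, hK'⟩ := D.exists_abs_cost_le (max |z₁| |z₂|) T
  set δ := min (D.mass z₁ - D.mass s) (D.mass s - D.mass z₂) with hδ
  have hδ0 : 0 < δ := lt_min (sub_pos.2 hz₁) (sub_pos.2 hz₂)
  have hδ1 : δ ≤ D.mass z₁ - D.mass s := min_le_left _ _
  have hδ2 : δ ≤ D.mass s - D.mass z₂ := min_le_right _ _
  refine ⟨(K + K') / δ, by positivity, fun t x y h0 hT hy => ⟨fun hx => ?_, fun hx => ?_⟩⟩
  · by_contra hcon
    push Not at hcon
    have h1 := hy z₁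
    have h2 := hK t y h0 hT
    have h3 := (abs_le.1 (hK' t z₁ h0 hT (abs_le.1 (le_max_left _ _)))).2
    simp only [cost_eq] at h1 h2 h3
    rw [div_lt_iff₀ hδ0] at hx
    have hx0 : 0 < x := by
      by_contra hneg
      push Not at hneg
      nlinarith
    have h4 : x * δ ≤ x * (D.mass z₁ - D.mass y) := by gcongr; linarith
    linarith
  · by_contra hcon
    push Not at hcon
    have h1 := hy z₂
    have h2 := hK t y h0 hT
    have h3 := (abs_le.1 (hK' t z₂ h0 hT (abs_le.1 (le_max_right _ _)))).2
    simp only [cost_eq] at h1 h2 h3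
    have hx' : (K + K') / δ < -x := by linarith
    rw [div_lt_iff₀ hδ0] at hx'
    have hx0 : 0 < -x := by
      by_contra hneg
      push Not at hneg
      nlinarith
    have h4 : -x * δ ≤ -x * (D.mass y - D.mass z₂) := by gcongr; linarith
    linarith

theorem Interior.flow_eq {s t : ℝ} (hs : D.Interior s) (ht : 0 ≤ t) :
    D.flow t s = sInf {x | ∃ y, D.IsMin x t y ∧ D.mass s ≤ D.mass y} := by
  rw [flow, if_pos hs, max_eq_left ht]

theorem Interior.nonempty_bddBelow {s t : ℝ} (hs : D.Interior s) (ht : 0 ≤ t) :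
    {x | ∃ y, D.IsMin x t y ∧ D.mass s ≤ D.mass y}.Nonempty ∧
      BddBelow {x | ∃ y, D.IsMin x t y ∧ D.mass s ≤ D.mass y} := by
  obtain ⟨R, hR0, hR⟩ := hs.exists_bound t
  constructor
  · obtain ⟨y, hy⟩ := D.exists_isMin (R + 1) ht
    exact ⟨R + 1, y, hy, ((hR t _ y ht le_rfl hy).1 (by linarith)).le⟩
  · refine ⟨-R, fun x ⟨y, hy, hsy⟩ => ?_⟩
    by_contra hx
    exact hsy.not_gt ((hR t x y ht le_rfl hy).2 (not_le.1 hx))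

/-- The infimum defining the flow is attained: minimizers at points decreasing to `x` have a limit
in mass, which comes from a minimizer at `x`. -/
theorem Interior.flow_le_iff {s t : ℝ} (hs : D.Interior s) (ht : 0 ≤ t) {x : ℝ} :
    D.flow t s ≤ x ↔ ∃ y, D.IsMin x t y ∧ D.mass s ≤ D.mass y := by
  rw [hs.flow_eq ht]
  obtain ⟨hne, hbdd⟩ := hs.nonempty_bddBelow ht
  refine ⟨fun hx => ?_, fun h => csInf_le hbdd h⟩
  have key : ∀ n : ℕ, ∃ y, D.IsMin (x + 1 / ((n : ℝ) + 1)) t y ∧ D.mass s ≤ D.mass y := by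
    intro n
    have hpos : (0 : ℝ) < 1 / ((n : ℝ) + 1) := by positivity
    obtain ⟨x', ⟨y', hy', hs'⟩, hlt⟩ := (csInf_lt_iff hbdd hne).1 (hx.trans_lt
      (lt_add_of_pos_right x hpos))
    obtain ⟨y, hy⟩ := D.exists_isMin (x + 1 / ((n : ℝ) + 1)) ht
    exact ⟨y, hy, hs'.trans (hy'.mass_le hy hlt)⟩
  choose y hy hsy using key
  have hlim : Tendsto (fun n : ℕ => x + 1 / ((n : ℝ) + 1)) atTop (𝓝 x) := by
    simpa using tendsto_const_nhds.add (tendsto_one_div_add_atTop_nhds_zero_nat (𝕜 := ℝ))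
  obtain ⟨y', hy', φ, hφ⟩ := D.exists_isMin_of_tendsto ht hlim hy
  exact ⟨y', hy', ge_of_tendsto' hφ fun n => hsy _⟩

theorem Interior.flow_le_iff_of_greatest {s t x b : ℝ} (hs : D.Interior s) (ht : 0 ≤ t)
    (hb : D.IsMin x t b) (hmax : ∀ y, D.IsMin x t y → D.mass y ≤ D.mass b) :
    D.flow t s ≤ x ↔ D.mass s ≤ D.mass b := by
  rw [hs.flow_le_iff ht]
  exact ⟨fun ⟨y, hy, h⟩ => h.trans (hmax y hy), fun h => ⟨b, hb, h⟩⟩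

theorem Interior.exists_isMin_of_le_flow {s t x : ℝ} (hs : D.Interior s) (ht : 0 ≤ t)
    (hx : x ≤ D.flow t s) : ∃ y, D.IsMin x t y ∧ D.mass y ≤ D.mass s := by
  have key : ∀ n : ℕ, ∃ y, D.IsMin (x - 1 / ((n : ℝ) + 1)) t y ∧ D.mass y ≤ D.mass s := by
    intro n
    have hpos : (0 : ℝ) < 1 / ((n : ℝ) + 1) := by positivity
    obtain ⟨y, hy⟩ := D.exists_isMin (x - 1 / ((n : ℝ) + 1)) ht
    refine ⟨y, hy, ?_⟩
    by_contra hcon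
    have := (hs.flow_le_iff ht).2 ⟨y, hy, (not_le.1 hcon).le⟩
    linarith
  choose y hy hsy using key
  have hlim : Tendsto (fun n : ℕ => x - 1 / ((n : ℝ) + 1)) atTop (𝓝 x) := by
    simpa using tendsto_const_nhds.sub (tendsto_one_div_add_atTop_nhds_zero_nat (𝕜 := ℝ))
  obtain ⟨y', hy', φ, hφ⟩ := D.exists_isMin_of_tendsto ht hlim hy
  exact ⟨y', hy', le_of_tendsto' hφ fun n => hsy _⟩

theorem Interior.le_flow_of_mass_lt {s t x y : ℝ} (hs : D.Interior s) (ht : 0 ≤ t)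
    (hy : D.IsMin x t y) (h : D.mass y < D.mass s) : x ≤ D.flow t s := by
  by_contra hlt
  push Not at hlt
  obtain ⟨z, hz, hsz⟩ := (hs.flow_le_iff ht).1 le_rfl
  exact (h.trans_le hsz).not_ge (hz.mass_le hy hlt)

/-- The case `mass a = mass s` has to be excluded: if `x` lies in a vacuum just to the right of the
particle, the flow is less than `x` although the masses agree. -/
theorem Interior.flow_lt_iff_of_least {s t x a : ℝ} (hs : D.Interior s) (ht : 0 ≤ t)
    (ha : D.IsMin x t a) (hmin : ∀ y, D.IsMin x t y → D.mass a ≤ D.mass y)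
    (hne : D.mass a ≠ D.mass s) :
    D.flow t s < x ↔ D.mass s < D.mass a := by
  constructor
  · intro h
    by_contra hcon
    exact h.not_ge (hs.le_flow_of_mass_lt ht ha ((not_lt.1 hcon).lt_of_ne hne))
  · intro h
    by_contra hcon
    obtain ⟨y, hy, hys⟩ := hs.exists_isMin_of_le_flow ht (not_lt.1 hcon)
    exact (h.trans_le (hmin y hy)).not_ge hys

theorem Interior.exists_abs_flow_le {s : ℝ} (hs : D.Interior s) (T : ℝ) :
    ∃ R, 0 ≤ R ∧ ∀ t, 0 ≤ t → t ≤ T → |D.flow t s| ≤ R := by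
  obtain ⟨R, hR0, hR⟩ := hs.exists_bound T
  refine ⟨R, hR0, fun t h0 hT => abs_le.2 ⟨?_, ?_⟩⟩
  · obtain ⟨y, hy, hsy⟩ := (hs.flow_le_iff h0).1 le_rfl
    by_contra h
    exact hsy.not_gt ((hR t _ y h0 hT hy).2 (not_le.1 h))
  · obtain ⟨y, hy, hsy⟩ := hs.exists_isMin_of_le_flow h0 le_rfl
    by_contra h
    exact hsy.not_gt ((hR t _ y h0 hT hy).1 (not_le.1 h))

theorem Interior.flow_mono {s s' : ℝ} (hs : D.Interior s) (hs' : D.Interior s') (h : s ≤ s')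
    {t : ℝ} (ht : 0 ≤ t) : D.flow t s ≤ D.flow t s' := by
  obtain ⟨y, hy, hsy⟩ := (hs'.flow_le_iff ht).1 le_rfl
  exact (hs.flow_le_iff ht).2 ⟨y, hy, (D.mass_mono h).trans hsy⟩

variable (D)

theorem exists_abs_vel_le (S T : ℝ) : ∃ L, 0 ≤ L ∧ ∀ t s : ℝ, 0 ≤ t → t ≤ T → s ∈ Icc (-S) S →
    |D.vel t s| ≤ L := by
  obtain ⟨K, hK⟩ := (isCompact_Icc.prod isCompact_Icc :
    IsCompact (Icc 0 T ×ˢ Icc (-S) S)).exists_bound_of_continuousOn D.continuous_vel.continuousOn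
  exact ⟨max K 0, le_max_right _ _, fun t y h0 hT hy =>
    (hK (t, y) ⟨⟨h0, hT⟩, hy⟩).trans (le_max_left _ _)⟩

/-- The position is quadratic in time, so the velocity at the midpoint gives the exact increment. -/
theorem pos_sub_pos (t τ s : ℝ) : D.pos τ s - D.pos t s = (τ - t) * D.vel ((t + τ) / 2) s := by
  simp only [pos, vel]
  ring

variable {D}

/-- Let `L` bound the free velocities of the labels involved. If the path moved faster, some `x₁`
beyond `x + L * |τ - t|` would have a minimizer `z₁` below `s` at time `τ`, while `x` has a
minimizer `z` at or above `s` in mass at time `t`. Minimality of both makes the integral of `(pos τ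
- x₁) - (pos t - x)` over `[z₁, z]` nonnegative, but the integrand is negative. -/
theorem Interior.exists_lipschitz {s : ℝ} (hs : D.Interior s) (T : ℝ) :
    ∃ L, 0 ≤ L ∧ ∀ t τ, 0 ≤ t → t ≤ T → 0 ≤ τ → τ ≤ T →
      |D.flow τ s - D.flow t s| ≤ L * |τ - t| := by
  obtain ⟨R, hR0, hR⟩ := hs.exists_abs_flow_le T
  obtain ⟨S, hS0, hS⟩ := D.exists_mem_Icc_of_isMin R T
  obtain ⟨L, hL0, hL⟩ := D.exists_abs_vel_le S T
  have key : ∀ t τ, 0 ≤ t → t ≤ T → 0 ≤ τ → τ ≤ T →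
      D.flow τ s - D.flow t s ≤ L * |τ - t| := by
    intro t τ ht htT hτ hτT
    by_contra hcon
    push Not at hcon
    set x := D.flow t s
    set x' := D.flow τ s
    obtain ⟨x₁, hx₁, hx₁'⟩ := exists_between (lt_sub_iff_add_lt.1 hcon)
    have hL' : 0 ≤ L * |τ - t| := by positivity
    have hx := abs_le.1 (hR t ht htT)
    have hx' := abs_le.1 (hR τ hτ hτT)
    have hx₁R : |x₁| ≤ R := abs_le.2 ⟨by linarith, by linarith⟩
    obtain ⟨y, hy, hsy⟩ := (hs.flow_le_iff ht).1 (le_refl x)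
    obtain ⟨y₁, hy₁⟩ := D.exists_isMin x₁ hτ
    have hsy₁ : D.mass y₁ < D.mass s := by
      by_contra h
      exact hx₁'.not_ge ((hs.flow_le_iff hτ).2 ⟨y₁, hy₁, not_lt.1 h⟩)
    obtain ⟨z, hz, hzm, hzmin⟩ := hS x t y (hR t ht htT) ht htT hy
    obtain ⟨z₁, hz₁, hzm₁, hzmin₁⟩ := hS x₁ τ y₁ hx₁R hτ hτT hy₁
    have hlt : D.mass z₁ < D.mass z := by rw [hzm, hzm₁]; exact hsy₁.trans_le hsy
    have hzz : z₁ < z := D.mass_mono.reflect_lt hlt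
    have h1 := hzmin z₁
    have h2 := hzmin₁ z
    have e1 := D.cost_sub_cost x t z₁ z
    have e2 := D.cost_sub_cost x₁ τ z₁ z
    have hc := D.continuous_pos_right t
    have hc' := D.continuous_pos_right τ
    have i1 : IntervalIntegrable (fun σ => D.pos t σ - x) D.μ z₁ z :=
      (hc.sub continuous_const).intervalIntegrable _ _
    have i2 : IntervalIntegrable (fun σ => D.pos τ σ - x₁) D.μ z₁ z :=
      (hc'.sub continuous_const).intervalIntegrable _ _
    have e3 := intervalIntegral.integral_sub i2 i1
    have hle : ∫ σ in z₁..z, (D.pos τ σ - x₁ - (D.pos t σ - x)) ∂D.μ ≤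
        ∫ _ in z₁..z, (L * |τ - t| - (x₁ - x)) * (1 : ℝ) ∂D.μ := by
      refine intervalIntegral.integral_mono_on hzz.le (i2.sub i1) intervalIntegrable_const ?_
      intro σ hσ
      have hσ' : σ ∈ Icc (-S) S := ⟨hz₁.1.trans hσ.1, hσ.2.trans hz.2⟩
      have h3 := hL ((t + τ) / 2) σ (by linarith) (by linarith) hσ'
      have h4 := D.pos_sub_pos t τ σ
      have h5 : (τ - t) * D.vel ((t + τ) / 2) σ ≤ L * |τ - t| := by
        refine (le_abs_self _).trans ?_
        rw [abs_mul, mul_comm]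
        gcongr
      linarith
    rw [intervalIntegral.integral_const_mul, ← mass_sub_mass] at hle
    have hneg : (L * |τ - t| - (x₁ - x)) * (D.mass z - D.mass z₁) < 0 :=
      mul_neg_of_neg_of_pos (by linarith) (by linarith)
    linarith
  refine ⟨L, hL0, fun t τ ht htT hτ hτT => abs_le.2 ⟨?_, key t τ ht htT hτ hτT⟩⟩
  have := key τ t hτ hτT ht htT
  rw [abs_sub_comm] at this
  linarith

/-- At time `0` the integrand is `σ - x`, so `x` itself is a minimizer at `x`. -/
theorem flow_zero {s : ℝ} (hs : D.Interior s) (hg : D.Generic s) : D.flow 0 s = s := by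
  have hmin : ∀ x, D.IsMin x 0 x := by
    intro x z
    have h := D.cost_sub_cost x 0 x z
    suffices 0 ≤ ∫ σ in x..z, (D.pos 0 σ - x) ∂D.μ by linarith
    have hp : ∀ σ, D.pos 0 σ - x = σ - x := fun σ => by simp [pos]
    simp only [hp]
    rcases le_total x z with hxz | hxz
    · exact intervalIntegral.integral_nonneg hxz fun σ hσ => sub_nonneg.2 hσ.1
    · rw [intervalIntegral.integral_symm, ← intervalIntegral.integral_neg]
      exact intervalIntegral.integral_nonneg hxz fun σ hσ => by linarith [hσ.2]
  refine le_antisymm ((hs.flow_le_iff le_rfl).2 ⟨s, hmin s, le_rfl⟩) ?_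
  by_contra hlt
  push Not at hlt
  obtain ⟨x, hx1, hx2⟩ := exists_between hlt
  obtain ⟨y, hy, hsy⟩ := (hs.flow_le_iff le_rfl).1 le_rfl
  exact (hsy.trans (hy.mass_le (hmin x) hx1)).not_gt (hg.mass_lt_iff.2 hx2)

variable (D)

/-- The flow is frozen at negative times, which makes it continuous in time on all of `ℝ` and hence
jointly measurable. -/
theorem flow_max (t s : ℝ) : D.flow (max t 0) s = D.flow t s := by
  simp [flow]

theorem continuous_flow (s : ℝ) : Continuous fun t => D.flow t s := by
  by_cases hs : D.Interior s
  · have hcont : ContinuousOn (fun t => D.flow t s) (Ici 0) := by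
      intro t ht
      obtain ⟨L, hL0, hL⟩ := hs.exists_lipschitz (t + 1)
      have : ContinuousOn (fun t => D.flow t s) (Icc 0 (t + 1)) := by
        refine (LipschitzOnWith.of_dist_le_mul (K := ⟨L, hL0⟩) fun a ha b hb => ?_).continuousOn
        rw [Real.dist_eq, Real.dist_eq]
        exact hL b a hb.1 hb.2 ha.1 ha.2
      refine (this t ⟨ht, by linarith⟩).mono_of_mem_nhdsWithin ?_
      exact inter_mem_nhdsWithin _ (Iic_mem_nhds (by linarith))
    have h2 : Continuous fun t : ℝ => D.flow (max t 0) s :=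
      hcont.comp_continuous (by fun_prop) fun t => mem_Ici.2 (le_max_right _ _)
    simpa only [flow_max] using h2
  · simp only [flow, if_neg hs]
    exact continuous_const

theorem measurable_flow_right (t : ℝ) : Measurable (D.flow t) := by
  have hI : MeasurableSet {s | D.Interior s} :=
    (D.continuous_mass.measurable measurableSet_Ioi).inter
      (D.continuous_mass.measurable measurableSet_Iio)
  have hm : Measurable fun s : {s | D.Interior s} => D.flow t s := by
    refine Monotone.measurable fun a b hab => ?_
    rw [← D.flow_max t, ← D.flow_max t]
    exact a.2.flow_mono b.2 hab (le_max_right _ _)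
  refine measurable_of_restrict_of_restrict_compl hI hm ?_
  have : ({s | D.Interior s}ᶜ).domRestrict (D.flow t) = fun _ => 0 := by
    funext s
    exact if_neg s.2
  rw [this]
  exact measurable_const

theorem measurable_flow : Measurable (Function.uncurry D.flow) :=
  measurable_uncurry_of_continuous_of_measurable D.continuous_flow D.measurable_flow_right

end InitialData
end EulerPoisson

namespace EulerPoisson
namespace InitialData

variable (D : InitialData)

/-! ### Mass density and velocity -/

/-- The distribution of mass at time `t`. -/
def density (t : ℝ) : Measure ℝ := D.μ.map (D.flow t)

/-- The mass of the atom at `x`. -/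
def atomMass (t x : ℝ) : ℝ := D.μ.real {s | D.flow t s = x}

/-- The momentum of the atom at `x`. -/
def atomMomentum (t x : ℝ) : ℝ := ∫ s, if D.flow t s = x then D.vel t s else 0 ∂D.μ

/-- The mass in `(-∞, x]` at time `t`. -/
def massBelow (t x : ℝ) : ℝ := D.μ.real {s | D.flow t s ≤ x}

open Classical in
/-- The label of a particle with a given mass to its left. -/
def label (r : ℝ) : ℝ := if r ∈ Ioo 0 D.total then sInf {s | r ≤ D.mass s} else 0

open Classical in
/-- The velocity field: atoms move with the average velocity of their particles. -/
def velocity (t x : ℝ) : ℝ :=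
  if D.atomMass t x = 0 then D.vel t (D.label (D.massBelow t x))
  else D.atomMomentum t x / D.atomMass t x

instance (t : ℝ) : IsFiniteMeasure (D.density t) := by
  unfold density; infer_instance

theorem measurable_flow_comp : Measurable fun p : (ℝ × ℝ) × ℝ => D.flow p.1.1 p.2 :=
  D.measurable_flow.comp (by fun_prop : Measurable fun p : (ℝ × ℝ) × ℝ => (p.1.1, p.2))

theorem measurableSet_flow_eq :
    MeasurableSet {p : (ℝ × ℝ) × ℝ | D.flow p.1.1 p.2 = p.1.2} :=
  measurableSet_eq_fun D.measurable_flow_comp (by fun_prop)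

theorem measurable_atomMass : Measurable (Function.uncurry D.atomMass) :=
  (measurable_measure_prodMk_left D.measurableSet_flow_eq).ennreal_toReal

theorem measurable_massBelow : Measurable (Function.uncurry D.massBelow) :=
  (measurable_measure_prodMk_left
    (measurableSet_le D.measurable_flow_comp (measurable_snd.comp measurable_fst))).ennreal_toReal

theorem measurable_atomMomentum : Measurable (Function.uncurry D.atomMomentum) := by
  have h : Measurable fun p : (ℝ × ℝ) × ℝ =>
      if D.flow p.1.1 p.2 = p.1.2 then D.vel p.1.1 p.2 else 0 :=
    Measurable.ite D.measurableSet_flow_eq (D.continuous_vel.measurable.comp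
      (by fun_prop : Measurable fun p : (ℝ × ℝ) × ℝ => (p.1.1, p.2))) measurable_const
  exact (h.stronglyMeasurable.integral_prod_right' (ν := D.μ)).measurable

theorem measurable_label : Measurable D.label := by
  refine measurable_of_restrict_of_restrict_compl (s := Ioo 0 D.total) measurableSet_Ioo ?_ ?_
  · refine Monotone.measurable fun a b hab => ?_
    simp only [domRestrict_apply, label, if_pos a.2, if_pos b.2]
    refine csInf_le_csInf ?_ ?_ fun s (hs : (b : ℝ) ≤ D.mass s) =>
      le_trans (Subtype.coe_le_coe.2 hab) hs
    · obtain ⟨z, hz⟩ := (D.tendsto_mass_atBot.eventually_lt_const a.2.1).exists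
      exact ⟨z, fun s hs => (D.mass_mono.reflect_lt (lt_of_lt_of_le hz hs)).le⟩
    · obtain ⟨z, hz⟩ := (D.tendsto_mass_atTop.eventually_const_lt b.2.2).exists
      exact ⟨z, hz.le⟩
  · have : (Ioo 0 D.total)ᶜ.domRestrict D.label = fun _ => 0 := by
      funext s
      exact if_neg s.2
    rw [this]
    exact measurable_const

theorem measurable_velocity : Measurable (Function.uncurry D.velocity) := by
  have h : Measurable fun p : ℝ × ℝ => D.vel p.1 (D.label (D.massBelow p.1 p.2)) :=
    D.continuous_vel.measurable.comp
      (measurable_fst.prodMk (D.measurable_label.comp D.measurable_massBelow))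
  have h' : Measurable fun p : ℝ × ℝ => D.atomMomentum p.1 p.2 / D.atomMass p.1 p.2 :=
    D.measurable_atomMomentum.div D.measurable_atomMass
  have hs : MeasurableSet {p : ℝ × ℝ | D.atomMass p.1 p.2 = 0} :=
    D.measurable_atomMass (measurableSet_singleton 0)
  exact Measurable.ite hs h h'

theorem measurable_velocity_right (t : ℝ) : Measurable (D.velocity t) :=
  D.measurable_velocity.of_uncurry_left

theorem measurable_density : Measurable D.density := by
  refine Measure.measurable_of_measurable_coe _ fun B hB => ?_
  have : (fun t => D.density t B) =
      fun t => D.μ (Prod.mk t ⁻¹' (Function.uncurry D.flow ⁻¹' B)) := by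
    funext t
    rw [density, Measure.map_apply (D.measurable_flow_right t) hB]
    rfl
  rw [this]
  exact measurable_measure_prodMk_left (D.measurable_flow hB)

variable {D}

theorem label_mass {s : ℝ} (hs : D.Interior s) (hg : D.Generic s) : D.label (D.mass s) = s := by
  rw [label, if_pos (show D.mass s ∈ Ioo 0 D.total from hs)]
  have : {s' | D.mass s ≤ D.mass s'} = Ici s := by
    ext b
    exact hg.mass_le_iff
  rw [this, csInf_Ici]

/-- The flow preserves the order of labels, and without an atom the labels sharing the position of
`s` are negligible. Thus the label can be read off from the position. -/
theorem massBelow_flow {s t : ℝ} (hs : D.Interior s) (ht : 0 ≤ t)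
    (h0 : D.atomMass t (D.flow t s) = 0) : D.massBelow t (D.flow t s) = D.mass s := by
  refine measureReal_congr ?_
  have h : ∀ᵐ s' ∂D.μ, D.flow t s' ≠ D.flow t s := by
    rw [ae_iff]
    simpa [atomMass, measureReal_eq_zero_iff] using h0
  rw [eventuallyEq_set]
  filter_upwards [h, D.ae_interior] with s' hne hs'
  constructor
  · intro hle
    by_contra hcon
    exact hne (le_antisymm hle (hs.flow_mono hs' (not_le.1 hcon).le ht))
  · exact fun hle => hs'.flow_mono hs hle ht

theorem velocity_flow_of_atomMass_eq_zero {s t : ℝ} (hs : D.Interior s) (hg : D.Generic s)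
    (ht : 0 ≤ t) (h0 : D.atomMass t (D.flow t s) = 0) :
    D.velocity t (D.flow t s) = D.vel t s := by
  rw [velocity, if_pos h0, massBelow_flow hs ht h0, label_mass hs hg]

variable (D)

theorem exists_mem_Icc_of_abs_flow_le (R T : ℝ) : ∃ S, 0 ≤ S ∧ ∀ t s : ℝ, 0 ≤ t → t ≤ T →
    D.Interior s → D.Generic s → |D.flow t s| ≤ R → s ∈ Icc (-S) S := by
  obtain ⟨S, hS0, hS⟩ := D.exists_mass_mem_of_isMin R T
  refine ⟨S, hS0, fun t s h0 hT hs hg hR => ⟨?_, ?_⟩⟩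
  · obtain ⟨y, hy, hys⟩ := hs.exists_isMin_of_le_flow h0 le_rfl
    rw [← not_lt, ← hg.lt_mass_iff, not_lt]
    exact (hS _ t y hR h0 hT hy).1.trans hys
  · obtain ⟨y, hy, hys⟩ := (hs.flow_le_iff h0).1 le_rfl
    exact hg.mass_le_iff.1 (hys.trans (hS _ t y hR h0 hT hy).2)

theorem exists_abs_vel_le_of_abs_flow_le (R T : ℝ) : ∃ L, 0 ≤ L ∧ ∀ t s : ℝ, 0 ≤ t → t ≤ T →
    D.Interior s → D.Generic s → |D.flow t s| ≤ R → |D.vel t s| ≤ L := by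
  obtain ⟨S, hS0, hS⟩ := D.exists_mem_Icc_of_abs_flow_le R T
  obtain ⟨L, hL0, hL⟩ := D.exists_abs_vel_le S T
  exact ⟨L, hL0, fun t s h0 hT hs hg hR => hL t s h0 hT (hS t s h0 hT hs hg hR)⟩

theorem exists_abs_velocity_le (R T : ℝ) : ∃ L, 0 ≤ L ∧ ∀ t s : ℝ, 0 ≤ t → t ≤ T →
    D.Interior s → D.Generic s → |D.flow t s| ≤ R → |D.velocity t (D.flow t s)| ≤ L := by
  obtain ⟨L, hL0, hL⟩ := D.exists_abs_vel_le_of_abs_flow_le R T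
  refine ⟨L, hL0, fun t s h0 hT hs hg hR => ?_⟩
  by_cases hq : D.atomMass t (D.flow t s) = 0
  · rw [velocity_flow_of_atomMass_eq_zero hs hg h0 hq]
    exact hL t s h0 hT hs hg hR
  · have hqpos : 0 < D.atomMass t (D.flow t s) := measureReal_nonneg.lt_of_ne (Ne.symm hq)
    rw [velocity, if_neg hq, abs_div, abs_of_pos hqpos, div_le_iff₀ hqpos]
    have hset : MeasurableSet {s' | D.flow t s' = D.flow t s} :=
      D.measurable_flow_right t (measurableSet_singleton _)
    have e : D.atomMomentum t (D.flow t s) =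
        ∫ s' in {s' | D.flow t s' = D.flow t s}, D.vel t s' ∂D.μ := by
      rw [← integral_indicator hset]
      rfl
    rw [e]
    have hae : ∀ᵐ s' ∂D.μ, s' ∈ {s' | D.flow t s' = D.flow t s} → ‖D.vel t s'‖ ≤ L := by
      filter_upwards [D.ae_interior, D.ae_generic] with s' hs' hg' heq
      refine hL t s' h0 hT hs' hg' ?_
      rwa [show D.flow t s' = D.flow t s from heq]
    exact norm_setIntegral_le_of_norm_le_const_ae' (measure_lt_top D.μ _) hae

/-! ### Averages over the labels at a common position -/

variable {h : ℝ → ℝ} {R K : ℝ}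

theorem exists_ae_abs_vel_mul_le (t : ℝ) (ht : 0 ≤ t) (hR : ∀ x, R < |x| → h x = 0)
    (hK : ∀ᵐ s ∂D.μ, |h (D.flow t s)| ≤ K) :
    ∃ L, ∀ᵐ s ∂D.μ, |D.vel t s * h (D.flow t s)| ≤ L := by
  obtain ⟨L, hL0, hL⟩ := D.exists_abs_vel_le_of_abs_flow_le R t
  refine ⟨L * K, ?_⟩
  filter_upwards [D.ae_interior, D.ae_generic, hK] with s hs hg hk
  rcases le_or_gt |D.flow t s| R with hle | hlt
  · rw [abs_mul]
    have := hL t s ht le_rfl hs hg hle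
    gcongr
  · rw [hR _ hlt, mul_zero, abs_zero]
    exact mul_nonneg hL0 ((abs_nonneg _).trans hk)

theorem integrable_vel_mul {t : ℝ} (ht : 0 ≤ t) (hm : Measurable h)
    (hR : ∀ x, R < |x| → h x = 0) (hK : ∀ᵐ s ∂D.μ, |h (D.flow t s)| ≤ K) :
    Integrable (fun s => D.vel t s * h (D.flow t s)) D.μ := by
  obtain ⟨L, hL⟩ := D.exists_ae_abs_vel_mul_le t ht hR hK
  exact Integrable.of_bound ((D.continuous_vel_right t).measurable.mul
    (hm.comp (D.measurable_flow_right t))).aestronglyMeasurable L hL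

/-- Averaging over the fibers of a map: `g(T) p(T)` and `g(T) q(T) w` have the same integral when
`q` and `p` are the integrals of `1` and `w` over the fibers of `T`. -/
theorem _root_.EulerPoisson.integral_fiber {μ : Measure ℝ} [IsFiniteMeasure μ] {T w g q p : ℝ → ℝ}
    (hT : Measurable T) (hw : Measurable w) (hg : Measurable g)
    (hq : ∀ x c : ℝ, ∫ s, (T ⁻¹' {x}).indicator (fun _ => c) s ∂μ = q x * c)
    (hp : ∀ x, ∫ s, (T ⁻¹' {x}).indicator w s ∂μ = p x)
    (hint : Integrable (fun s => g (T s) * q (T s) * w s) μ) :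
    Integrable (fun s => g (T s) * p (T s)) μ ∧
      ∫ s, g (T s) * p (T s) ∂μ = ∫ s, g (T s) * q (T s) * w s ∂μ := by
  have hset : MeasurableSet {z : ℝ × ℝ | T z.2 = T z.1} :=
    measurableSet_eq_fun (hT.comp measurable_snd) (hT.comp measurable_fst)
  -- `F` couples labels in the same fiber. Integration in `s'` first produces `p`, integration in
  -- `s` first produces `q`, and Fubini equates the two.
  let F : ℝ → ℝ → ℝ := fun s s' => g (T s') * (T ⁻¹' {T s}).indicator w s'
  have hF : ∀ s s', F s s' = (T ⁻¹' {T s'}).indicator (fun _ => g (T s') * w s') s := by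
    intro s s'
    by_cases h : T s' = T s
    · simp [F, indicator, h]
    · simp [F, indicator, h, Ne.symm h]
  have hF' : ∀ s s', F s s' = g (T s) * (T ⁻¹' {T s}).indicator w s' := by
    intro s s'
    by_cases h : T s' = T s
    · simp [F, indicator, h]
    · simp [F, indicator, h]
  have hFm : Measurable (Function.uncurry F) :=
    (hg.comp (hT.comp measurable_snd)).mul ((hw.comp measurable_snd).indicator hset)
  have e1 : ∀ s, ∫ s', F s s' ∂μ = g (T s) * p (T s) := by
    intro s
    simp only [hF']
    rw [integral_const_mul, hp]
  have e2 : ∀ s', ∫ s, F s s' ∂μ = g (T s') * q (T s') * w s' := by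
    intro s'
    simp only [hF]
    rw [hq]
    ring
  have hFint : Integrable (Function.uncurry F) (μ.prod μ) := by
    rw [integrable_prod_iff' hFm.aestronglyMeasurable]
    constructor
    · refine Eventually.of_forall fun s' => ?_
      simp only [Function.uncurry, hF]
      exact (integrable_const _).indicator (hT (measurableSet_singleton _))
    · refine hint.norm.congr (Eventually.of_forall fun s' => ?_)
      have hn : ∀ s, ‖F s s'‖ = (T ⁻¹' {T s'}).indicator (fun _ => ‖g (T s') * w s'‖) s := by
        intro s
        rw [hF, norm_indicator_eq_indicator_norm]
      have hq0 : 0 ≤ q (T s') := by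
        rw [← mul_one (q _), ← hq]
        exact integral_nonneg fun s => indicator_nonneg (fun _ _ => zero_le_one) s
      simp only [Function.uncurry, hn]
      rw [hq, norm_mul, norm_mul, norm_mul, Real.norm_of_nonneg hq0]
      ring
  have hswap := integral_integral_swap hFint
  simp only [e1, e2] at hswap
  have i1 := hFint.integral_prod_left
  simp only [Function.uncurry, e1] at i1
  exact ⟨i1, hswap⟩

/-- The velocity field is the conditional average of the free velocities. -/
theorem integral_velocity_mul {t : ℝ} (ht : 0 ≤ t) (hm : Measurable h)
    (hR : ∀ x, R < |x| → h x = 0) (hK : ∀ᵐ s ∂D.μ, |h (D.flow t s)| ≤ K) :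
    ∫ s, D.velocity t (D.flow t s) * h (D.flow t s) ∂D.μ =
      ∫ s, D.vel t s * h (D.flow t s) ∂D.μ := by
  have hT := D.measurable_flow_right t
  have hv := (D.continuous_vel_right t).measurable
  have hqm : Measurable (D.atomMass t) := D.measurable_atomMass.of_uncurry_left
  have hint := D.integrable_vel_mul ht hm hR hK
  -- On `Z`, the labels in no atom, the velocity field already equals `vel`; averaging over fibers,
  -- with weight `h / atomMass`, is needed only on the complement.
  obtain ⟨Z, hZ⟩ : ∃ Z : Set ℝ, Z = {s | D.atomMass t (D.flow t s) = 0} := ⟨_, rfl⟩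
  have hZm : MeasurableSet Z := hZ ▸ (hqm.comp hT) (measurableSet_singleton 0)
  have hgq : ∀ s, h (D.flow t s) / D.atomMass t (D.flow t s) * D.atomMass t (D.flow t s) *
      D.vel t s = Zᶜ.indicator (fun s => D.vel t s * h (D.flow t s)) s := by
    intro s
    by_cases hs : D.atomMass t (D.flow t s) = 0
    · have : s ∉ Zᶜ := by simp [hZ, hs]
      rw [indicator_of_notMem this, hs]
      simp
    · have : s ∈ Zᶜ := by simpa [hZ] using hs
      rw [indicator_of_mem this, div_mul_cancel₀ _ hs, mul_comm]
  obtain ⟨i1, e1⟩ := integral_fiber (μ := D.μ) (w := D.vel t) (q := D.atomMass t)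
    (p := D.atomMomentum t) (g := fun x => h x / D.atomMass t x) hT hv (hm.div hqm)
    (fun x c => by
      rw [integral_indicator (hT (measurableSet_singleton x)), setIntegral_const, smul_eq_mul]
      rfl)
    (fun x => rfl)
    (by
      simp only [hgq]
      exact hint.indicator hZm.compl)
  simp only [hgq] at e1
  have l : ∫ s, D.velocity t (D.flow t s) * h (D.flow t s) ∂D.μ =
      ∫ s, (Z.indicator (fun s => D.vel t s * h (D.flow t s)) s +
        h (D.flow t s) / D.atomMass t (D.flow t s) * D.atomMomentum t (D.flow t s)) ∂D.μ := by
    refine integral_congr_ae ?_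
    filter_upwards [D.ae_interior, D.ae_generic] with s hs hgen
    by_cases hx : D.atomMass t (D.flow t s) = 0
    · have : s ∈ Z := by simpa [hZ] using hx
      rw [indicator_of_mem this, velocity_flow_of_atomMass_eq_zero hs hgen ht hx, hx]
      simp
    · have : s ∉ Z := by simpa [hZ] using hx
      rw [indicator_of_notMem this, velocity, if_neg hx]
      ring
  rw [l, integral_add (hint.indicator hZm) i1, e1,
    ← integral_add (hint.indicator hZm) (hint.indicator hZm.compl)]
  simp only [indicator_self_add_compl_apply]

theorem electricField_density (t x : ℝ) : electricField (D.density t) x =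
    (D.μ.real {s | D.flow t s < x} + D.massBelow t x) / 2 := by
  have hT := D.measurable_flow_right t
  rw [electricField, density, map_measureReal_apply hT measurableSet_Iio,
    map_measureReal_apply hT measurableSet_Iic]
  rfl

theorem _root_.EulerPoisson.measurable_electricField (ν : Measure ℝ) [IsFiniteMeasure ν] :
    Measurable (electricField ν) := by
  have h1 : Monotone fun x => ν.real (Iio x) := fun a b hab =>
    measureReal_mono (Iio_subset_Iio hab)
  have h2 : Monotone fun x => ν.real (Iic x) := fun a b hab =>
    measureReal_mono (Iic_subset_Iic.2 hab)
  exact (h1.measurable.add h2.measurable).div_const 2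

theorem abs_electricField_density_le (t x : ℝ) : |electricField (D.density t) x| ≤ D.total := by
  have h1 : D.μ.real {s | D.flow t s < x} ≤ D.total := measureReal_mono (subset_univ _)
  have h2 : D.massBelow t x ≤ D.total := measureReal_mono (subset_univ _)
  have h3 : 0 ≤ D.μ.real {s | D.flow t s < x} := measureReal_nonneg
  have h4 : 0 ≤ D.massBelow t x := measureReal_nonneg
  rw [electricField_density, abs_of_nonneg (by positivity)]
  linarith

theorem integrable_mass_mul {t : ℝ} (hm : Measurable h) (hK : ∀ x, |h x| ≤ K) :
    Integrable (fun s => D.mass s * h (D.flow t s)) D.μ := by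
  refine Integrable.of_bound (D.continuous_mass.measurable.mul
    (hm.comp (D.measurable_flow_right t))).aestronglyMeasurable (D.total * K)
    (Eventually.of_forall fun s => ?_)
  rw [norm_mul]
  exact mul_le_mul (D.abs_mass_le s) (hK _) (norm_nonneg _) D.total_nonneg

theorem integrable_electricField_mul {t : ℝ} (hm : Measurable h) (hK : ∀ x, |h x| ≤ K) :
    Integrable (fun s => electricField (D.density t) (D.flow t s) * h (D.flow t s)) D.μ := by
  have hT := D.measurable_flow_right t
  refine Integrable.of_bound (((measurable_electricField _).comp hT).mul
    (hm.comp hT)).aestronglyMeasurable (D.total * K) (Eventually.of_forall fun s => ?_)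
  rw [norm_mul]
  exact mul_le_mul (D.abs_electricField_density_le t _) (hK _) (norm_nonneg _) D.total_nonneg

/-- The electric field is the conditional average of the mass to the left. -/
theorem integral_electricField_mul {t : ℝ} (ht : 0 ≤ t) (hm : Measurable h)
    (hK : ∀ x, |h x| ≤ K) :
    ∫ s, electricField (D.density t) (D.flow t s) * h (D.flow t s) ∂D.μ =
      ∫ s, D.mass s * h (D.flow t s) ∂D.μ := by
  classical
  have hT := D.measurable_flow_right t
  -- Apart from the factor `h`, this is for almost all pairs the indicator of `s' ≤ s` minus the
  -- half-sum of the indicators of `flow t s' < flow t s` and `flow t s' ≤ flow t s`. It is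
  -- antisymmetric, so its double integral vanishes.
  set k : ℝ → ℝ → ℝ := fun s s' =>
    (if D.flow t s' = D.flow t s then (if s' < s then 1 / 2 else if s < s' then -1 / 2 else 0)
      else 0) * h (D.flow t s) with hk
  have hkm : Measurable (Function.uncurry k) := by
    refine Measurable.mul (Measurable.ite (measurableSet_eq_fun (hT.comp measurable_snd)
      (hT.comp measurable_fst)) (Measurable.ite (measurableSet_lt measurable_snd measurable_fst)
      measurable_const (Measurable.ite (measurableSet_lt measurable_fst measurable_snd)
      measurable_const measurable_const)) measurable_const) (hm.comp (hT.comp measurable_fst))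
  have hkint : Integrable (Function.uncurry k) (D.μ.prod D.μ) := by
    refine Integrable.of_bound hkm.aestronglyMeasurable K (Eventually.of_forall fun p => ?_)
    have h0 := abs_nonneg (h (D.flow t p.1))
    have h1 := hK (D.flow t p.1)
    simp only [Function.uncurry, hk, Real.norm_eq_abs, abs_mul]
    split_ifs <;> norm_num <;> linarith
  have hanti : ∀ s s', k s' s = -k s s' := by
    intro s s'
    simp only [hk]
    by_cases hx : D.flow t s = D.flow t s'
    · rcases lt_trichotomy s s' with hlt | heq | hlt
      · simp [hx, hlt, hlt.not_gt]; ring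
      · simp [heq]
      · simp [hx, hlt, hlt.not_gt]; ring
    · simp [hx, Ne.symm hx]
  have hzero : ∫ s, ∫ s', k s s' ∂D.μ ∂D.μ = 0 := by
    have h1 := integral_integral_swap hkint
    have h2 : ∫ s', ∫ s, k s s' ∂D.μ ∂D.μ = -∫ s, ∫ s', k s s' ∂D.μ ∂D.μ := by
      rw [← integral_neg]
      congr 1
      funext s
      rw [← integral_neg]
      congr 1
      funext s'
      exact hanti s s'
    linarith
  have hind : ∀ A : Set ℝ, MeasurableSet A → Integrable (A.indicator fun _ => (1 : ℝ)) D.μ :=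
    fun A hA => (integrable_const 1).indicator hA
  have hin : ∀ᵐ s ∂D.μ, ∫ s', k s s' ∂D.μ =
      D.mass s * h (D.flow t s) - electricField (D.density t) (D.flow t s) * h (D.flow t s) := by
    filter_upwards [D.ae_interior] with s hs
    have m1 : MeasurableSet {s' | D.flow t s' < D.flow t s} := hT measurableSet_Iio
    have m2 : MeasurableSet {s' | D.flow t s' ≤ D.flow t s} := hT measurableSet_Iic
    have e1 : D.mass s = ∫ s', (Iic s).indicator (fun _ => (1 : ℝ)) s' ∂D.μ := by
      rw [integral_indicator measurableSet_Iic]; simp [mass]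
    have e2 : D.μ.real {s' | D.flow t s' < D.flow t s} =
        ∫ s', {s' | D.flow t s' < D.flow t s}.indicator (fun _ => (1 : ℝ)) s' ∂D.μ := by
      rw [integral_indicator m1]; simp
    have e3 : D.massBelow t (D.flow t s) =
        ∫ s', {s' | D.flow t s' ≤ D.flow t s}.indicator (fun _ => (1 : ℝ)) s' ∂D.μ := by
      rw [integral_indicator m2]; simp [massBelow]
    have i3 : Integrable (fun s' => ({s' | D.flow t s' < D.flow t s}.indicator
        (fun _ => (1 : ℝ)) s' +
          {s' | D.flow t s' ≤ D.flow t s}.indicator (fun _ => (1 : ℝ)) s') / 2) D.μ := ((hind _ m1).add (hind _ m2)).div_const 2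
    rw [electricField_density, ← sub_mul, e1, e2, e3,
      ← integral_add (hind _ m1) (hind _ m2), ← integral_div, ← integral_sub
        (hind _ measurableSet_Iic) i3, ← integral_mul_const]
    refine integral_congr_ae ?_
    have hne : ∀ᵐ s' ∂D.μ, s' ≠ s := by
      rw [ae_iff]; simp
    filter_upwards [D.ae_interior, hne] with s' hs' hne
    simp only [hk, indicator, mem_Iic, mem_ofPred_eq]
    congr 1
    rcases lt_or_gt_of_ne hne with hlt | hlt
    · have hle := hs'.flow_mono hs hlt.le ht
      rcases hle.eq_or_lt with heq | hlt'
      · simp [heq, hlt, hlt.le]; norm_num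
      · simp [hlt'.ne, hlt', hlt.le, hlt'.le]
    · have hle := hs.flow_mono hs' hlt.le ht
      rcases hle.eq_or_lt with heq | hlt'
      · simp [heq, hlt, hlt.not_ge, hlt.not_gt]; norm_num
      · simp [hlt'.ne', hlt.not_ge, hlt'.not_ge, hlt'.not_gt]
  rw [integral_congr_ae hin] at hzero
  rw [integral_sub (D.integrable_mass_mul hm hK) (D.integrable_electricField_mul hm hK)] at hzero
  linarith

end InitialData
end EulerPoisson

namespace EulerPoisson
namespace InitialData

variable (D : InitialData)

/-! ### Particle paths follow the velocity field -/

/-- The minimal value of the functional. -/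
def minCost (x t : ℝ) : ℝ := sInf (range (D.cost x t))

variable {D}

theorem IsMin.minCost_eq {x t y : ℝ} (h : D.IsMin x t y) : D.minCost x t = D.cost x t y :=
  IsLeast.csInf_eq ⟨mem_range_self y, by rintro _ ⟨z, rfl⟩; exact h z⟩

/-- A minimizer at time `t`, chosen in a compact interval, competes at time `τ`, and the cost of a
label there is Lipschitz along the path. -/
theorem Interior.minCost_lipschitz {s : ℝ} (hs : D.Interior s) (T : ℝ) (hT : 0 ≤ T) :
    ∃ L, 0 ≤ L ∧ ∀ t τ, 0 ≤ t → t ≤ T → 0 ≤ τ → τ ≤ T →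
      |D.minCost (D.flow τ s) τ - D.minCost (D.flow t s) t| ≤ L * |τ - t| := by
  obtain ⟨R, hR0, hR⟩ := hs.exists_abs_flow_le T
  obtain ⟨S, hS0, hS⟩ := D.exists_mem_Icc_of_isMin R T
  obtain ⟨L, hL0, hL⟩ := hs.exists_lipschitz T
  obtain ⟨K, hK⟩ := (isCompact_Icc (a := -S) (b := S)).exists_bound_of_continuousOn
    D.continuous_costB.continuousOn
  have hK0 : 0 ≤ K := (norm_nonneg _).trans (hK 0 ⟨by linarith, hS0⟩)
  have hc0 : 0 ≤ |D.κ| * D.total * D.total :=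
    mul_nonneg (mul_nonneg (abs_nonneg _) D.total_nonneg) D.total_nonneg
  set c := |D.κ| * D.total * D.total with hc
  refine ⟨K + 2 * T * c + L * D.total, by have := D.total_nonneg; positivity, ?_⟩
  have key : ∀ t τ, 0 ≤ t → t ≤ T → 0 ≤ τ → τ ≤ T →
      D.minCost (D.flow τ s) τ - D.minCost (D.flow t s) t ≤
        (K + 2 * T * c + L * D.total) * |τ - t| := by
    intro t τ ht htT hτ hτT
    obtain ⟨y₀, hy₀⟩ := D.exists_isMin (D.flow t s) ht
    obtain ⟨y, hy, -, hmin⟩ := hS _ t y₀ (hR t ht htT) ht htT hy₀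
    obtain ⟨z, hz⟩ := D.exists_isMin (D.flow τ s) hτ
    rw [hz.minCost_eq, hmin.minCost_eq]
    have h1 := hz y
    have h2 := hL t τ ht htT hτ hτT
    have h3 := hK y hy
    have h4 := D.abs_costC_le y
    have e : D.cost (D.flow τ s) τ y - D.cost (D.flow t s) t y = (τ - t) * D.costB y +
        (τ - t) * ((τ + t) * D.costC y) -
          (D.flow τ s - D.flow t s) * (D.mass y - D.mass 0) := by
      simp only [cost_eq]; ring
    have b1 : |(τ - t) * D.costB y| ≤ |τ - t| * K := by
      rw [abs_mul]; gcongr; exact h3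
    have b2 : |(τ - t) * ((τ + t) * D.costC y)| ≤ |τ - t| * (2 * T * c) := by
      rw [abs_mul, abs_mul]; gcongr
      rw [abs_of_nonneg (by linarith)]; linarith
    have b3 : |(D.flow τ s - D.flow t s) * (D.mass y - D.mass 0)| ≤
        L * |τ - t| * D.total := by
      rw [abs_mul]
      gcongr
      rw [abs_le]
      constructor <;> linarith [D.mass_nonneg y, D.mass_nonneg 0, D.mass_le_total y,
        D.mass_le_total 0]
    have := abs_le.1 b1
    have := abs_le.1 b2
    have := abs_le.1 b3
    linarith
  intro t τ ht htT hτ hτT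
  refine abs_le.2 ⟨?_, key t τ ht htT hτ hτT⟩
  have := key τ t hτ hτT ht htT
  rw [abs_sub_comm] at this
  linarith

theorem _root_.EulerPoisson.ae_differentiableAt_of_lipschitz {f : ℝ → ℝ}
    (hf : ∀ T : ℝ, 0 ≤ T → ∃ L, 0 ≤ L ∧ ∀ t τ, 0 ≤ t → t ≤ T → 0 ≤ τ → τ ≤ T →
      |f τ - f t| ≤ L * |τ - t|) : ∀ᵐ t, 0 < t → DifferentiableAt ℝ f t := by
  have h : ∀ᵐ t : ℝ, ∀ n : ℕ, t ∈ Icc (0 : ℝ) n → DifferentiableWithinAt ℝ f (Icc 0 n) t := by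
    rw [ae_all_iff]
    intro n
    obtain ⟨L, hL0, hL⟩ := hf n n.cast_nonneg
    refine LipschitzOnWith.ae_differentiableWithinAt_of_mem_real (C := ⟨L, hL0⟩)
      (LipschitzOnWith.of_dist_le_mul fun a ha b hb => ?_)
    rw [Real.dist_eq, Real.dist_eq]
    exact hL b a hb.1 hb.2 ha.1 ha.2
  filter_upwards [h] with t ht h0
  obtain ⟨n, hn⟩ := exists_nat_gt t
  exact (ht n ⟨h0.le, hn.le⟩).differentiableAt (Icc_mem_nhds h0 hn)

variable (D)

theorem hasDerivAt_cost {x : ℝ → ℝ} {x' t : ℝ} (hx : HasDerivAt x x' t) (y : ℝ) :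
    HasDerivAt (fun τ => D.cost (x τ) τ y)
      (D.costB y + 2 * t * D.costC y - x' * D.mass y + x' * D.mass 0) t := by
  simp only [cost_eq]
  have h1 : HasDerivAt (fun τ : ℝ => τ) 1 t := hasDerivAt_id t
  have h2 : HasDerivAt (fun τ : ℝ => τ ^ 2) (2 * t) t := by simpa using hasDerivAt_pow 2 t
  have := (((((h1.mul_const (D.costB y)).const_add (D.costA y)).add
    (h2.mul_const (D.costC y))).sub (hx.mul_const (D.mass y))).add (hx.mul_const (D.mass 0)))
  rw [one_mul] at this
  exact this

/-- At almost every time, the derivative of a path satisfies the jump condition with respect to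
any two minimizers on the path. -/
theorem jump_condition {x : ℝ → ℝ} {x' t a b : ℝ} (ht : 0 < t) (hx : HasDerivAt x x' t)
    (hη : DifferentiableAt ℝ (fun τ => D.minCost (x τ) τ) t) (ha : D.IsMin (x t) t a)
    (hb : D.IsMin (x t) t b) :
    ∫ s in a..b, D.vel t s ∂D.μ = x' * (D.mass b - D.mass a) := by
  -- Envelope argument: the cost of `y` along the path minus the minimal cost is nonnegative near
  -- `t` and zero at `t`, so its derivative vanishes. The resulting value does not depend on `y`.
  have key : ∀ y, D.IsMin (x t) t y → D.costB y + 2 * t * D.costC y - x' * D.mass y +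
      x' * D.mass 0 = deriv (fun τ => D.minCost (x τ) τ) t := by
    intro y hy
    have hd := (D.hasDerivAt_cost hx y).sub hη.hasDerivAt
    have hmin : IsLocalMin ((fun τ => D.cost (x τ) τ y) - fun τ => D.minCost (x τ) τ) t := by
      filter_upwards [lt_mem_nhds ht] with τ hτ
      obtain ⟨z, hz⟩ := D.exists_isMin (x τ) hτ.le
      simp only [Pi.sub_apply]
      rw [hy.minCost_eq, hz.minCost_eq, sub_self, sub_nonneg]
      exact hz y
    exact sub_eq_zero.1 (hmin.hasDerivAt_eq_zero hd)
  have h := (key b hb).trans (key a ha).symm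
  have e : ∫ s in a..b, D.vel t s ∂D.μ = D.costB b - D.costB a +
      2 * t * (D.costC b - D.costC a) := by
    have h1 := D.continuous_u0
    have h2 := D.continuous_mass
    have c2 : Continuous fun s => 1 / 2 * D.κ * D.mass s := by fun_prop
    rw [costB, costB, costC, costC,
      intervalIntegral.integral_interval_sub_left (h1.intervalIntegrable _ _)
        (h1.intervalIntegrable _ _),
      intervalIntegral.integral_interval_sub_left (c2.intervalIntegrable _ _)
        (c2.intervalIntegrable _ _), ← intervalIntegral.integral_const_mul,
      ← intervalIntegral.integral_add (h1.intervalIntegrable _ _)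
        ((c2.const_mul _).intervalIntegrable _ _)]
    congr 1
    funext s
    simp only [vel]
    ring
  rw [e]
  linarith

theorem exists_extremal_isMin (x : ℝ) {t : ℝ} (ht : 0 ≤ t) :
    ∃ a b, a ≤ b ∧ D.IsMin x t a ∧ D.IsMin x t b ∧
      (∀ y, D.IsMin x t y → D.mass a ≤ D.mass y) ∧ ∀ y, D.IsMin x t y → D.mass y ≤ D.mass b := by
  obtain ⟨a, ha, hmin⟩ := D.exists_least_isMin x ht
  obtain ⟨b, hb, hmax⟩ := D.exists_greatest_isMin x ht
  rcases le_total a b with h | h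
  · exact ⟨a, b, h, ha, hb, hmin, hmax⟩
  · exact ⟨a, a, le_rfl, ha, ha, hmin, fun y hy => (hmax y hy).trans (D.mass_mono h)⟩

variable {D}

/-- Almost all labels up to `b` are at or left of `x`, and those up to `a` are strictly left of it.
-/
theorem flow_eq_ae_eq_Ioc {x t a b : ℝ} (ht : 0 ≤ t) (ha : D.IsMin x t a) (hb : D.IsMin x t b)
    (hmin : ∀ y, D.IsMin x t y → D.mass a ≤ D.mass y)
    (hmax : ∀ y, D.IsMin x t y → D.mass y ≤ D.mass b) :
    {s | D.flow t s = x} =ᵐ[D.μ] Ioc a b := by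
  have hne : ∀ᵐ s ∂D.μ, s ≠ a := by rw [ae_iff]; simp
  rw [eventuallyEq_set]
  filter_upwards [D.ae_interior, D.ae_generic, hne] with s hs hg hne
  have h1 := hs.flow_le_iff_of_greatest ht hb hmax
  have h2 := hs.flow_lt_iff_of_least ht ha hmin (hg a hne.symm)
  rw [hg.lt_mass_iff] at h2
  rw [hg.mass_le_iff] at h1
  change D.flow t s = x ↔ _
  rw [mem_Ioc, ← h1]
  constructor
  · intro h
    refine ⟨?_, h.le⟩
    by_contra hcon
    exact h.not_lt (h2.2 ((not_lt.1 hcon).lt_of_ne hne))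
  · rintro ⟨h3, h4⟩
    exact h4.antisymm (not_lt.1 fun h5 => h3.not_gt (h2.1 h5))

theorem atomMass_eq {x t a b : ℝ} (ht : 0 ≤ t) (hab : a ≤ b) (ha : D.IsMin x t a)
    (hb : D.IsMin x t b) (hmin : ∀ y, D.IsMin x t y → D.mass a ≤ D.mass y)
    (hmax : ∀ y, D.IsMin x t y → D.mass y ≤ D.mass b) :
    D.atomMass t x = D.mass b - D.mass a := by
  rw [← D.measureReal_Ioc hab]
  exact measureReal_congr (flow_eq_ae_eq_Ioc ht ha hb hmin hmax)

theorem atomMomentum_eq {x t a b : ℝ} (ht : 0 ≤ t) (hab : a ≤ b) (ha : D.IsMin x t a)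
    (hb : D.IsMin x t b) (hmin : ∀ y, D.IsMin x t y → D.mass a ≤ D.mass y)
    (hmax : ∀ y, D.IsMin x t y → D.mass y ≤ D.mass b) :
    D.atomMomentum t x = ∫ s in a..b, D.vel t s ∂D.μ := by
  have hset : MeasurableSet {s | D.flow t s = x} :=
    D.measurable_flow_right t (measurableSet_singleton _)
  rw [intervalIntegral.integral_of_le hab,
    ← setIntegral_congr_set (flow_eq_ae_eq_Ioc ht ha hb hmin hmax), ← integral_indicator hset]
  rfl

/-- A minimizer without mass-free neighborhoods is a critical point. -/
theorem Generic.pos_eq_of_isMin {s x t : ℝ} (hg : D.Generic s) (h : D.IsMin x t s) :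
    D.pos t s = x := by
  have hc := D.continuous_pos_right t
  have aux : ∀ {a b : ℝ} {f : ℝ → ℝ}, a < b → D.mass a < D.mass b → Continuous f →
      (∀ σ ∈ Icc a b, 0 < f σ) → 0 < ∫ σ in a..b, f σ ∂D.μ := by
    intro a b f hab hm hf hpos
    rw [intervalIntegral.integral_pos_iff_support_of_nonneg_ae'
      ((ae_restrict_iff' measurableSet_uIoc).2 (Eventually.of_forall fun σ hσ => ?_))
      (hf.intervalIntegrable _ _)]
    · refine ⟨hab, ?_⟩
      have : Function.support f ∩ Ioc a b = Ioc a b :=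
        inter_eq_right.2 fun σ hσ => (hpos σ (Ioc_subset_Icc_self hσ)).ne'
      rw [this]
      have h2 := D.measureReal_Ioc hab.le
      by_contra h0
      rw [measureReal_def, nonpos_iff_eq_zero.1 (not_lt.1 h0)] at h2
      simp at h2
      linarith
    · rw [uIoc_of_le hab.le] at hσ
      exact (hpos σ (Ioc_subset_Icc_self hσ)).le
  rcases lt_trichotomy (D.pos t s) x with hlt | heq | hgt
  -- The integrand is negative just to the right of `s`, where a generic label has mass, so a move
  -- to the right would lower the cost.
  · exfalso
    obtain ⟨ε, hε, hball⟩ := Metric.eventually_nhds_iff.1 (hc.continuousAt.eventually_lt_const hlt)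
    have h1 : s < s + ε / 2 := by linarith
    have h2 := aux h1 (hg.lt_mass_iff.2 h1) (continuous_const.sub hc : Continuous fun σ =>
      x - D.pos t σ) fun σ hσ => by
        refine sub_pos.2 (hball ?_)
        rw [Real.dist_eq, abs_of_nonneg (by linarith [hσ.1])]
        linarith [hσ.2]
    simp only [Pi.sub_apply] at h2
    have h3 := D.cost_sub_cost x t s (s + ε / 2)
    have h4 : ∫ σ in s..(s + ε / 2), (x - D.pos t σ) ∂D.μ =
        -∫ σ in s..(s + ε / 2), (D.pos t σ - x) ∂D.μ := by
      rw [← intervalIntegral.integral_neg]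
      simp
    linarith [h (s + ε / 2)]
  · exact heq
  · exfalso
    obtain ⟨ε, hε, hball⟩ := Metric.eventually_nhds_iff.1 (hc.continuousAt.eventually_const_lt hgt)
    have h1 : s - ε / 2 < s := by linarith
    have h2 := aux h1 (hg.mass_lt_iff.2 h1) (hc.sub continuous_const : Continuous fun σ =>
      D.pos t σ - x) fun σ hσ => by
        refine sub_pos.2 (hball ?_)
        rw [Real.dist_eq, abs_of_nonpos (by linarith [hσ.2])]
        linarith [hσ.1]
    simp only [Pi.sub_apply] at h2
    have h3 := D.cost_sub_cost x t (s - ε / 2) s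
    linarith [h (s - ε / 2)]

/-- Without an atom the extremal minimizers have equal mass, and `mass s` is squeezed between them.
-/
theorem isMin_of_atomMass_eq_zero {s t : ℝ} (hs : D.Interior s) (ht : 0 ≤ t)
    (h0 : D.atomMass t (D.flow t s) = 0) : D.IsMin (D.flow t s) t s := by
  obtain ⟨a, b, hab, ha, hb, hmin, hmax⟩ := D.exists_extremal_isMin (D.flow t s) ht
  rw [atomMass_eq ht hab ha hb hmin hmax] at h0
  obtain ⟨y, hy, hys⟩ := hs.exists_isMin_of_le_flow ht le_rfl
  have h1 := (hs.flow_le_iff_of_greatest ht hb hmax).1 le_rfl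
  exact hb.of_mass_eq (by linarith [hmin y hy])

theorem _root_.EulerPoisson.ae_uniqueDiffWithinAt (N : Set ℝ) :
    ∀ᵐ t : ℝ, t ∈ N → UniqueDiffWithinAt ℝ N t := by
  have hc := (countable_setOfPred_isolated_right_within (s := N)).ae_notMem volume
  filter_upwards [hc] with t ht htN
  rw [uniqueDiffWithinAt_iff_accPt, accPt_principal_iff_nhdsWithin]
  have : (𝓝[N ∩ Ioi t] t).NeBot := ⟨fun h => ht ⟨htN, h⟩⟩
  exact this.mono (nhdsWithin_mono _ fun τ hτ => ⟨hτ.1, hτ.2.ne'⟩)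

theorem hasDerivAt_pos (D : InitialData) (t s : ℝ) :
    HasDerivAt (fun τ => D.pos τ s) (D.vel t s) t := by
  have h1 : HasDerivAt (fun τ : ℝ => τ) 1 t := hasDerivAt_id t
  have h2 : HasDerivAt (fun τ : ℝ => τ ^ 2) (2 * t) t := by simpa using hasDerivAt_pow 2 t
  have := ((h1.mul_const (D.u0 s)).const_add s).add (h2.const_mul (1 / 2 * D.κ * D.mass s))
  have e : 1 * D.u0 s + 1 / 2 * D.κ * D.mass s * (2 * t) = D.vel t s := by
    simp only [vel]; ring
  rw [e] at this
  exact this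

/-- Particle paths follow the velocity field. -/
theorem ae_hasDerivAt_flow {s : ℝ} (hs : D.Interior s) (hg : D.Generic s) :
    ∀ᵐ t, 0 < t → HasDerivAt (fun τ => D.flow τ s) (D.velocity t (D.flow t s)) t := by
  have h1 := ae_differentiableAt_of_lipschitz (f := fun τ => D.flow τ s)
    fun T _ => hs.exists_lipschitz T
  have h2 := ae_differentiableAt_of_lipschitz (f := fun τ => D.minCost (D.flow τ s) τ)
    fun T hT => hs.minCost_lipschitz T hT
  -- At the times in `N` the particle is in no atom and the path equals the free path. Their
  -- derivatives therefore agree wherever derivatives within `N` are unique.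
  set N := {t | 0 ≤ t ∧ D.atomMass t (D.flow t s) = 0} with hN
  filter_upwards [h1, h2, ae_uniqueDiffWithinAt N] with t h1 h2 h3 ht
  have hd := (h1 ht).hasDerivAt
  by_cases hq : D.atomMass t (D.flow t s) = 0
  · have htN : t ∈ N := ⟨ht.le, hq⟩
    have heq : ∀ τ ∈ N, D.flow τ s = D.pos τ s := fun τ hτ =>
      (hg.pos_eq_of_isMin (isMin_of_atomMass_eq_zero hs hτ.1 hτ.2)).symm
    have hd2 : HasDerivWithinAt (fun τ => D.flow τ s) (D.vel t s) N t :=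
      (D.hasDerivAt_pos t s).hasDerivWithinAt.congr heq (heq t htN)
    rw [velocity_flow_of_atomMass_eq_zero hs hg ht.le hq,
      ← (h3 htN).eq_deriv N hd.hasDerivWithinAt hd2]
    exact hd
  -- Between the extremal minimizers the jump condition reads: momentum of the atom equals its mass
  -- times the speed of the path.
  · obtain ⟨a, b, hab, ha, hb, hmin, hmax⟩ := D.exists_extremal_isMin (D.flow t s) ht.le
    have hj := D.jump_condition (x := fun τ => D.flow τ s) ht hd (h2 ht) ha hb
    have e1 := atomMass_eq ht.le hab ha hb hmin hmax
    have e2 := atomMomentum_eq ht.le hab ha hb hmin hmax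
    rw [velocity, if_neg hq, e2, hj, ← e1, mul_div_cancel_right₀ _ hq]
    exact hd

end InitialData
end EulerPoisson

namespace EulerPoisson

/-! ### Distributional derivatives of cumulative integrals -/

section Distrib

variable {μ : Measure ℝ} [IsFiniteMeasure μ] {T w f : ℝ → ℝ}

theorem locallyIntegrable_of_sub_eq (hT : Measurable T)
    (hw : Measurable w) (hint : ∀ R, Integrable ((T ⁻¹' Icc (-R) R).indicator w) μ)
    (hf : ∀ a b, a ≤ b → f b - f a = ∫ s, (T ⁻¹' Ioc a b).indicator w s ∂μ) :
    LocallyIntegrable f := by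
  rw [locallyIntegrable_iff]
  intro K hK
  obtain ⟨R, hR⟩ := hK.isBounded.exists_norm_le
  suffices h : IntegrableOn f (Icc (-R) R) from h.mono_set fun x hx => abs_le.1 (hR x hx)
  have hm : StronglyMeasurable fun x => ∫ s, (T ⁻¹' Ioc (-R) x).indicator w s ∂μ := by
    have hset : MeasurableSet {p : ℝ × ℝ | -R < T p.2 ∧ T p.2 ≤ p.1} :=
      (measurableSet_lt measurable_const (hT.comp measurable_snd)).inter
        (measurableSet_le (hT.comp measurable_snd) measurable_fst)
    exact (((hw.comp measurable_snd).indicator hset).stronglyMeasurable).integral_prod_right'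
      (f := fun p : ℝ × ℝ => {p : ℝ × ℝ | -R < T p.2 ∧ T p.2 ≤ p.1}.indicator
        (fun p => w p.2) p)
  have hb : IntegrableOn (fun x => f (-R) + ∫ s, (T ⁻¹' Ioc (-R) x).indicator w s ∂μ)
      (Icc (-R) R) := by
    refine Measure.integrableOn_of_bounded (M := |f (-R)| +
      ∫ s, |(T ⁻¹' Icc (-R) R).indicator w s| ∂μ) measure_Icc_lt_top.ne
      (measurable_const.add hm.measurable).aestronglyMeasurable
      ((ae_restrict_iff' measurableSet_Icc).2 (Eventually.of_forall fun x hx => ?_))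
    refine (norm_add_le _ _).trans (add_le_add le_rfl ?_)
    refine norm_integral_le_of_norm_le (hint R).norm (Eventually.of_forall fun s => ?_)
    have hsub : Ioc (-R) x ⊆ Icc (-R) R := fun y hy => ⟨hy.1.le, hy.2.trans hx.2⟩
    exact norm_indicator_le_of_subset (preimage_mono hsub) _ _
  refine hb.congr_fun (fun x hx => ?_) measurableSet_Icc
  simp only
  rw [← hf _ _ hx.1]
  ring

/-- Fubini: the integral of `φ'` over `[T s, ∞)` is `-φ (T s)`, and the constant `f (-r)` drops out
because `φ'` has integral zero. -/
theorem integral_mul_deriv_of_sub_eq (hT : Measurable T)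
    (hw : Measurable w) (hint : ∀ R, Integrable ((T ⁻¹' Icc (-R) R).indicator w) μ)
    (hf : ∀ a b, a ≤ b → f b - f a = ∫ s, (T ⁻¹' Ioc a b).indicator w s ∂μ)
    {φ : ℝ → ℝ} (hφ : ContDiff ℝ ∞ φ) (hc : HasCompactSupport φ) :
    ∫ x, f x * deriv φ x = -∫ s, φ (T s) * w s ∂μ := by
  have hloc := locallyIntegrable_of_sub_eq hT hw hint hf
  have hd : Continuous (deriv φ) := hφ.continuous_deriv (by simp)
  have hdc : HasCompactSupport (deriv φ) := hc.deriv
  obtain ⟨R, hR⟩ := hc.isCompact.isBounded.exists_norm_le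
  have hR' : ∀ x, R < |x| → φ x = 0 := fun x hx => by
    by_contra hne
    exact (hR x (subset_tsupport _ hne)).not_gt hx
  have hRd : ∀ x, R < |x| → deriv φ x = 0 := fun x hx => by
    by_contra hne
    exact (hR x (support_deriv_subset hne)).not_gt hx
  obtain ⟨r, hr0, hrR⟩ : ∃ r, 0 < r ∧ R < r :=
    ⟨|R| + 1, by positivity, by linarith [le_abs_self R]⟩
  have hφd : ∀ x, HasDerivAt φ (deriv φ x) x := fun x =>
    (hφ.differentiable (by simp) x).hasDerivAt
  have hzero : ∫ x, deriv φ x = 0 := by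
    exact integral_eq_zero_of_hasDerivAt_of_integrable hφd (hd.integrable_of_hasCompactSupport hdc)
      (hφ.continuous.integrable_of_hasCompactSupport hc)
  -- The indicator of `Icc (-r) r` is redundant where `deriv φ x ≠ 0`; it makes `k` integrable.
  let k : ℝ → ℝ → ℝ := fun x s =>
    deriv φ x * (T ⁻¹' Icc (-r) r).indicator w s * (if -r < T s ∧ T s ≤ x then 1 else 0)
  have hkm : Measurable (Function.uncurry k) := by
    refine ((hd.measurable.comp measurable_fst).mul
      ((hw.indicator (hT measurableSet_Icc)).comp measurable_snd)).mul
      (Measurable.ite ?_ measurable_const measurable_const)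
    exact (measurableSet_lt measurable_const (hT.comp measurable_snd)).inter
        (measurableSet_le (hT.comp measurable_snd) measurable_fst)
  have hkint : Integrable (Function.uncurry k) (volume.prod μ) := by
    refine ((hd.integrable_of_hasCompactSupport hdc).mul_prod (hint r)).mono
      hkm.aestronglyMeasurable (Eventually.of_forall fun p => ?_)
    simp only [Function.uncurry, k]
    rw [norm_mul]
    refine mul_le_of_le_one_right (norm_nonneg _) ?_
    split_ifs <;> simp
  have e1 : ∀ x, ∫ s, k x s ∂μ = (f x - f (-r)) * deriv φ x := by
    intro x
    rcases lt_or_ge R |x| with hx | hx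
    · simp [k, hRd x hx]
    · have hx' := abs_le.1 (hx.trans hrR.le)
      rw [hf _ _ hx'.1, mul_comm, ← integral_const_mul]
      congr 1
      funext s
      by_cases hs : -r < T s ∧ T s ≤ x
      · have h1 : s ∈ T ⁻¹' Icc (-r) r := ⟨hs.1.le, hs.2.trans hx'.2⟩
        have h2 : s ∈ T ⁻¹' Ioc (-r) x := hs
        simp only [k, if_pos hs, indicator_of_mem h1, indicator_of_mem h2, mul_one]
      · have h2 : s ∉ T ⁻¹' Ioc (-r) x := hs
        simp only [k, if_neg hs, indicator_of_notMem h2, mul_zero]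
  have e2 : ∀ s, ∫ x, k x s = -(φ (T s) * w s) := by
    intro s
    by_cases hs : T s ∈ Ioc (-r) r
    · have h1 : s ∈ T ⁻¹' Icc (-r) r := ⟨hs.1.le, hs.2⟩
      have : ∀ x, k x s = w s * (Ici (T s)).indicator (deriv φ) x := by
        intro x
        by_cases hx : T s ≤ x
        · have h2 : x ∈ Ici (T s) := hx
          simp [k, hx, hs.1, indicator_of_mem h1]
          ring
        · simp [k, hx]
      simp only [this]
      rw [integral_const_mul, integral_indicator measurableSet_Ici,
        integral_Ici_eq_integral_Ioi, hc.integral_Ioi_deriv_eq (hφ.of_le (by simp))]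
      ring
    · have h0 : φ (T s) = 0 := hR' _ (by
        by_contra hcon
        have := abs_le.1 (not_lt.1 hcon)
        exact hs ⟨by linarith, by linarith⟩)
      rw [h0, zero_mul, neg_zero]
      refine integral_eq_zero_of_ae (Eventually.of_forall fun x => ?_)
      by_cases h1 : -r < T s
      · have h2 : s ∉ T ⁻¹' Icc (-r) r := fun h => hs ⟨h1, h.2⟩
        simp [k, indicator_of_notMem h2]
      · simp [k, h1]
  have hswap := integral_integral_swap hkint
  simp only [e1, e2] at hswap
  have i1 : Integrable fun x => f x * deriv φ x :=
    hloc.integrable_smul_right_of_hasCompactSupport hd hdc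
  rw [integral_neg] at hswap
  rw [← hswap]
  simp only [sub_mul]
  rw [integral_sub i1 ((hd.integrable_of_hasCompactSupport hdc).const_mul _), integral_const_mul,
    hzero]
  ring

end Distrib

/-- The field differs from the distribution function of `ν` only at atoms, which are countably many.
-/
theorem hasDistribDeriv_electricField (ν : Measure ℝ) [IsFiniteMeasure ν] :
    HasDistribDeriv (electricField ν) ν fun _ => 1 := by
  have hcount : {x : ℝ | 0 < ν {x}}.Countable :=
    Measure.countable_meas_pos_of_disjoint_iUnion (fun x => measurableSet_singleton x)
      fun x y hxy => by simpa using hxy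
  have hae : (fun x => ν.real (Iic x)) =ᵐ[volume] electricField ν := by
    filter_upwards [hcount.ae_notMem volume] with x hx
    have h0 : ν {x} = 0 := by simpa using hx
    have : ν.real (Iic x) = ν.real (Iio x) := by
      rw [← Iio_union_right]
      exact measureReal_congr (union_ae_eq_left_of_ae_eq_empty (ae_eq_empty.2 h0))
    rw [electricField, this]
    ring
  have hf : ∀ a b : ℝ, a ≤ b → ν.real (Iic b) - ν.real (Iic a) =
      ∫ s, (id ⁻¹' Ioc a b).indicator (fun _ => (1 : ℝ)) s ∂ν := by
    intro a b hab
    have h := intervalIntegral.integral_Iic_sub_Iic (μ := ν) (f := fun _ : ℝ => (1 : ℝ)) (a := a)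
      (b := b) (integrable_const _) (integrable_const _)
    rw [preimage_id, integral_indicator measurableSet_Ioc, ← intervalIntegral.integral_of_le hab,
      ← h]
    simp
  have hint : ∀ R : ℝ, Integrable ((id ⁻¹' Icc (-R) R).indicator fun _ => (1 : ℝ)) ν := fun R =>
    (integrable_const 1).indicator measurableSet_Icc
  refine ⟨(locallyIntegrable_of_sub_eq measurable_id measurable_const hint hf).congr hae,
    locallyIntegrable_const 1, fun φ hφ hc => ?_⟩
  refine Eq.trans (integral_congr_ae ?_)
    (integral_mul_deriv_of_sub_eq measurable_id measurable_const hint hf hφ hc)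
  filter_upwards [hae] with x hx
  rw [hx]

theorem tendsto_electricField_atBot (ν : Measure ℝ) [IsFiniteMeasure ν] :
    Tendsto (electricField ν) atBot (𝓝 0) := by
  have h : Tendsto (fun x => ν.real (Iic x)) atBot (𝓝 0) := by
    have := tendsto_measure_iInter_atBot (μ := ν) (s := fun x : ℝ => Iic x)
      (fun x => measurableSet_Iic.nullMeasurableSet) (fun a b hab => Iic_subset_Iic.2 hab)
      ⟨0, measure_ne_top _ _⟩
    have h2 : ⋂ x : ℝ, Iic x = ∅ := by
      ext y
      simpa using ⟨y - 1, by linarith⟩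
    rw [h2, measure_empty] at this
    exact (ENNReal.tendsto_toReal ENNReal.zero_ne_top).comp this
  refine squeeze_zero (fun x => ?_) (fun x => ?_) h
  · unfold electricField; positivity
  · have : ν.real (Iio x) ≤ ν.real (Iic x) := measureReal_mono Iio_subset_Iic_self
    unfold electricField; linarith

end EulerPoisson

namespace EulerPoisson

/-! ### The weak formulation -/

section TestFunction

variable {φ : ℝ → ℝ → ℝ}

theorem deriv_left_eq (hφ : ContDiff ℝ ∞ (Function.uncurry φ)) (t x : ℝ) :
    deriv (fun s => φ s x) t = fderiv ℝ (Function.uncurry φ) (t, x) (1, 0) := by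
  have h := (hφ.differentiable (by simp) (t, x)).hasFDerivAt
  exact (h.comp_hasDerivAt t ((hasDerivAt_id t).prodMk (hasDerivAt_const t x))).deriv

theorem deriv_right_eq (hφ : ContDiff ℝ ∞ (Function.uncurry φ)) (t x : ℝ) :
    deriv (φ t) x = fderiv ℝ (Function.uncurry φ) (t, x) (0, 1) := by
  have h := (hφ.differentiable (by simp) (t, x)).hasFDerivAt
  exact (h.comp_hasDerivAt x ((hasDerivAt_const x t).prodMk (hasDerivAt_id x))).deriv

theorem hasDerivAt_along (hφ : ContDiff ℝ ∞ (Function.uncurry φ)) {x : ℝ → ℝ} {v t : ℝ}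
    (hx : HasDerivAt x v t) : HasDerivAt (fun τ => φ τ (x τ))
      (deriv (fun s => φ s (x t)) t + v * deriv (φ t) (x t)) t := by
  have h := (hφ.differentiable (by simp) (t, x t)).hasFDerivAt
  have h2 := h.comp_hasDerivAt t ((hasDerivAt_id t).prodMk hx)
  have e : ((1 : ℝ), v) = (1, 0) + v • (0, 1) := by simp
  rw [e, map_add, map_smul, smul_eq_mul, ← deriv_left_eq hφ, ← deriv_right_eq hφ] at h2
  exact h2

theorem continuous_deriv_left (hφ : ContDiff ℝ ∞ (Function.uncurry φ)) :
    Continuous fun p : ℝ × ℝ => deriv (fun s => φ s p.2) p.1 := by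
  simp only [deriv_left_eq hφ]
  exact (hφ.continuous_fderiv (by simp)).clm_apply continuous_const

theorem continuous_deriv_right (hφ : ContDiff ℝ ∞ (Function.uncurry φ)) :
    Continuous fun p : ℝ × ℝ => deriv (φ p.1) p.2 := by
  simp only [deriv_right_eq hφ]
  exact (hφ.continuous_fderiv (by simp)).clm_apply continuous_const

theorem exists_test_bounds (hφ : ContDiff ℝ ∞ (Function.uncurry φ))
    (hc : HasCompactSupport (Function.uncurry φ)) : ∃ R K, 0 ≤ R ∧ 0 ≤ K ∧
      (∀ t x, R < |t| ∨ R < |x| →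
        φ t x = 0 ∧ deriv (fun s => φ s x) t = 0 ∧ deriv (φ t) x = 0) ∧
      ∀ t x, |φ t x| ≤ K ∧ |deriv (fun s => φ s x) t| ≤ K ∧ |deriv (φ t) x| ≤ K := by
  obtain ⟨R, hR⟩ := hc.isCompact.isBounded.exists_norm_le
  have hfc : HasCompactSupport (fderiv ℝ (Function.uncurry φ)) := hc.fderiv ℝ
  obtain ⟨K₁, hK₁⟩ := hφ.continuous.bounded_above_of_compact_support hc
  obtain ⟨K₂, hK₂⟩ := (hφ.continuous_fderiv (by simp)).bounded_above_of_compact_support hfc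
  have hout : ∀ t x, max R 0 < |t| ∨ max R 0 < |x| → (t, x) ∉ tsupport (Function.uncurry φ) := by
    intro t x h hmem
    have h1 := norm_prod_le_iff.1 (hR _ hmem)
    have h2 := le_max_left R 0
    rcases h with h | h
    · exact (h1.1.trans h2).not_gt h
    · exact (h1.2.trans h2).not_gt h
  have h0 : ∀ t x, max R 0 < |t| ∨ max R 0 < |x| →
      fderiv ℝ (Function.uncurry φ) (t, x) = 0 := fun t x h => by
    by_contra hne
    exact hout t x h (support_fderiv_subset ℝ hne)
  have hv : ∀ (p v : ℝ × ℝ), ‖v‖ ≤ 1 → |fderiv ℝ (Function.uncurry φ) p v| ≤ K₂ := by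
    intro p v hv
    have h1 := (fderiv ℝ (Function.uncurry φ) p).le_opNorm v
    exact h1.trans ((mul_le_of_le_one_right (norm_nonneg _) hv).trans (hK₂ p))
  refine ⟨max R 0, max K₁ K₂, le_max_right _ _,
    le_max_of_le_left ((norm_nonneg _).trans (hK₁ (0, 0))), fun t x h => ⟨?_, ?_, ?_⟩,
    fun t x => ⟨?_, ?_, ?_⟩⟩
  · exact image_eq_zero_of_notMem_tsupport (f := Function.uncurry φ) (hout t x h)
  · rw [deriv_left_eq hφ, h0 t x h]; simp
  · rw [deriv_right_eq hφ, h0 t x h]; simp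
  · exact (hK₁ (t, x)).trans (le_max_left _ _)
  · rw [deriv_left_eq hφ]
    exact (hv _ _ (by simp)).trans (le_max_right _ _)
  · rw [deriv_right_eq hφ]
    exact (hv _ _ (by simp)).trans (le_max_right _ _)

end TestFunction

theorem integral_eq_sub_of_ae_hasDerivAt {f f' : ℝ → ℝ} {T : ℝ} (hT : 0 ≤ T)
    (hf : AbsolutelyContinuousOnInterval f 0 T) (hd : ∀ᵐ t, 0 < t → HasDerivAt f (f' t) t) :
    ∫ t in 0..T, f' t = f T - f 0 := by
  rw [← hf.integral_deriv_eq_sub]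
  refine intervalIntegral.integral_congr_ae ?_
  filter_upwards [hd] with t ht hmem
  rw [uIoc_of_le hT] at hmem
  exact (ht hmem.1).deriv.symm

/-! ### Integration along particle paths -/

namespace InitialData

variable (D : InitialData) {φ : ℝ → ℝ → ℝ} {α β : ℝ → ℝ}

/-- The integrand of the weak formulation in Lagrangian coordinates, for particles that carry the
quantity `α + t β`. -/
def lagrangian (φ : ℝ → ℝ → ℝ) (α β : ℝ → ℝ) (t s : ℝ) : ℝ :=
  (α s + t * β s) * (deriv (fun τ => φ τ (D.flow t s)) t +
    D.velocity t (D.flow t s) * deriv (φ t) (D.flow t s)) + β s * φ t (D.flow t s)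

theorem measurable_velocity_flow : Measurable fun p : ℝ × ℝ => D.velocity p.1 (D.flow p.1 p.2) :=
  D.measurable_velocity.comp (measurable_fst.prodMk D.measurable_flow)

theorem measurable_lagrangian (hφ : ContDiff ℝ ∞ (Function.uncurry φ)) (hα : Continuous α)
    (hβ : Continuous β) : Measurable (Function.uncurry (D.lagrangian φ α β)) := by
  have hp : Measurable fun p : ℝ × ℝ => (p.1, D.flow p.1 p.2) :=
    measurable_fst.prodMk D.measurable_flow
  have h1 := (continuous_deriv_left hφ).measurable.comp hp
  have h2 := (continuous_deriv_right hφ).measurable.comp hp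
  have h3 := hφ.continuous.measurable.comp hp
  have h4 := D.measurable_velocity_flow
  have h5 : Measurable fun p : ℝ × ℝ => α p.2 + p.1 * β p.2 := by
    have := hα.measurable; have := hβ.measurable; fun_prop
  exact (h5.mul (h1.add (h4.mul h2))).add ((hβ.measurable.comp measurable_snd).mul h3)

/-- The support of `φ` confines the contributing labels to a compact interval, on which `α` and `β`
are bounded; the velocity is bounded at the positions reached. -/
theorem exists_lagrangian_bounds (hφ : ContDiff ℝ ∞ (Function.uncurry φ))
    (hc : HasCompactSupport (Function.uncurry φ)) (hα : Continuous α) (hβ : Continuous β) :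
    ∃ R C, 0 ≤ R ∧ 0 ≤ C ∧ (∀ t x, R < |t| → φ t x = 0) ∧ ∀ t s, 0 ≤ t → D.Interior s →
      D.Generic s → |D.lagrangian φ α β t s| ≤ C ∧ (R < t → D.lagrangian φ α β t s = 0) := by
  obtain ⟨R, K, hR0, hK0, hout, hK⟩ := exists_test_bounds hφ hc
  obtain ⟨S, hS0, hS⟩ := D.exists_mem_Icc_of_abs_flow_le R R
  obtain ⟨L, hL0, hL⟩ := D.exists_abs_velocity_le R R
  obtain ⟨a, ha⟩ := (isCompact_Icc (a := -S) (b := S)).exists_bound_of_continuousOn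
    hα.continuousOn
  obtain ⟨b, hb⟩ := (isCompact_Icc (a := -S) (b := S)).exists_bound_of_continuousOn
    hβ.continuousOn
  have h0S : (0 : ℝ) ∈ Icc (-S) S := ⟨by linarith, hS0⟩
  have ha0 : 0 ≤ a := (norm_nonneg _).trans (ha 0 h0S)
  have hb0 : 0 ≤ b := (norm_nonneg _).trans (hb 0 h0S)
  have hzero : ∀ t s, R < |t| ∨ R < |D.flow t s| → D.lagrangian φ α β t s = 0 := by
    intro t s h
    obtain ⟨h1, h2, h3⟩ := hout t _ h
    rw [lagrangian, h1, h2, h3]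
    ring
  refine ⟨R, (a + R * b) * (K + L * K) + b * K, hR0, by positivity,
    fun t x h => (hout t x (Or.inl h)).1, fun t s ht hs hg => ⟨?_, fun h =>
      hzero t s (Or.inl (h.trans_le (le_abs_self t)))⟩⟩
  by_cases h : R < |t| ∨ R < |D.flow t s|
  · rw [hzero t s h, abs_zero]
    positivity
  · push Not at h
    have htR : t ≤ R := (le_abs_self t).trans h.1
    have hsS := hS t s ht htR hs hg h.2
    have h1 := hL t s ht htR hs hg h.2
    obtain ⟨h2, h3, h4⟩ := hK t (D.flow t s)
    have h5 : |α s| ≤ a := ha s hsS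
    have h6 : |β s| ≤ b := hb s hsS
    rw [lagrangian]
    refine (abs_add_le _ _).trans ?_
    rw [abs_mul, abs_mul]
    gcongr
    · refine (abs_add_le _ _).trans ?_
      rw [abs_mul]
      gcongr
      exact h.1
    · refine (abs_add_le _ _).trans ?_
      rw [abs_mul]
      gcongr

variable {D}

/-- The integrand is almost everywhere the time derivative of `(α s + t * β s) * φ t (flow t s)`, a
product of absolutely continuous functions. -/
theorem Interior.integral_lagrangian (hφ : ContDiff ℝ ∞ (Function.uncurry φ))
    (hc : HasCompactSupport (Function.uncurry φ)) {s : ℝ} (hs : D.Interior s) (hg : D.Generic s)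
    {T : ℝ} (hT : 0 ≤ T) (hφT : ∀ x, φ T x = 0) :
    ∫ t in 0..T, D.lagrangian φ α β t s = -(α s * φ 0 s) := by
  have hd : ∀ᵐ t, 0 < t → HasDerivAt (fun τ => (α s + τ * β s) * φ τ (D.flow τ s))
      (D.lagrangian φ α β t s) t := by
    filter_upwards [ae_hasDerivAt_flow hs hg] with t ht h0
    have h1 := hasDerivAt_along hφ (ht h0)
    have h2 := ((hasDerivAt_id t).mul_const (β s)).const_add (α s)
    have h3 := h2.mul h1
    have e : 1 * β s * φ t (D.flow t s) + (α s + id t * β s) *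
        (deriv (fun τ => φ τ (D.flow t s)) t +
          D.velocity t (D.flow t s) * deriv (φ t) (D.flow t s)) = D.lagrangian φ α β t s := by
      rw [lagrangian]
      simp only [id]
      ring
    rw [e] at h3
    exact h3
  obtain ⟨C, hC⟩ := hφ.lipschitzWith_of_hasCompactSupport hc (by simp)
  obtain ⟨L, hL0, hL⟩ := hs.exists_lipschitz T
  have hx : LipschitzOnWith ⟨L, hL0⟩ (fun t => D.flow t s) (uIcc 0 T) := by
    rw [uIcc_of_le hT]
    refine LipschitzOnWith.of_dist_le_mul fun a ha b hb => ?_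
    rw [Real.dist_eq, Real.dist_eq]
    exact hL b a hb.1 hb.2 ha.1 ha.2
  have hp := (LipschitzWith.id.lipschitzOnWith (s := uIcc 0 T)).prodMk hx
  have hac1 : AbsolutelyContinuousOnInterval (fun t => φ t (D.flow t s)) 0 T :=
    (hC.comp_lipschitzOnWith hp).absolutelyContinuousOnInterval
  have hac2 : AbsolutelyContinuousOnInterval (fun t => α s + t * β s) 0 T := by
    refine LipschitzOnWith.absolutelyContinuousOnInterval (K := ⟨|β s|, abs_nonneg _⟩)
      (LipschitzOnWith.of_dist_le_mul fun a _ b _ => ?_)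
    rw [Real.dist_eq, Real.dist_eq, add_sub_add_left_eq_sub, ← sub_mul, abs_mul, mul_comm]
    rfl
  rw [integral_eq_sub_of_ae_hasDerivAt hT (hac2.fun_mul hac1) hd, hφT, flow_zero hs hg]
  ring

variable (D)

theorem integral_integral_lagrangian (hφ : ContDiff ℝ ∞ (Function.uncurry φ))
    (hc : HasCompactSupport (Function.uncurry φ)) (hα : Continuous α) (hβ : Continuous β) :
    ∫ t in Ioi (0 : ℝ), ∫ s, D.lagrangian φ α β t s ∂D.μ = -∫ s, α s * φ 0 s ∂D.μ := by
  obtain ⟨R, C, hR0, hC0, hφR, hb⟩ := D.exists_lagrangian_bounds hφ hc hα hβ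
  -- Vanishing of `φ` is known only strictly beyond `R`.
  set T := R + 1 with hT
  have hT0 : 0 ≤ T := by linarith
  have hmeas := D.measurable_lagrangian hφ hα hβ
  have haes : ∀ᵐ s ∂D.μ, D.Interior s ∧ D.Generic s := D.ae_interior.and D.ae_generic
  have e1 : ∫ t in Ioi (0 : ℝ), ∫ s, D.lagrangian φ α β t s ∂D.μ =
      ∫ t in Ioc 0 T, ∫ s, D.lagrangian φ α β t s ∂D.μ := by
    refine setIntegral_eq_of_subset_of_forall_sdiff_eq_zero measurableSet_Ioi Ioc_subset_Ioi_self
      fun t ht => integral_eq_zero_of_ae ?_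
    have h1 : 0 < t := ht.1
    have h2 : T < t := by
      by_contra h
      exact ht.2 ⟨h1, not_lt.1 h⟩
    filter_upwards [haes] with s hs
    exact (hb t s h1.le hs.1 hs.2).2 (by linarith)
  have hint : Integrable (Function.uncurry (D.lagrangian φ α β))
      ((volume.restrict (Ioc 0 T)).prod D.μ) := by
    refine Integrable.of_bound hmeas.aestronglyMeasurable C ?_
    have h1 : ∀ᵐ p ∂(volume.restrict (Ioc 0 T)).prod D.μ, D.Interior p.2 ∧ D.Generic p.2 :=
      Measure.quasiMeasurePreserving_snd.ae haes
    have h2 : ∀ᵐ p ∂(volume.restrict (Ioc 0 T)).prod D.μ, p.1 ∈ Ioc 0 T :=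
      Measure.quasiMeasurePreserving_fst.ae (ae_restrict_mem measurableSet_Ioc)
    filter_upwards [h1, h2] with p hp1 hp2
    exact (hb p.1 p.2 hp2.1.le hp1.1 hp1.2).1
  rw [e1, integral_integral_swap hint, ← integral_neg]
  refine integral_congr_ae ?_
  filter_upwards [haes] with s hs
  rw [← intervalIntegral.integral_of_le hT0]
  exact hs.1.integral_lagrangian hφ hc hs.2 hT0 fun x =>
    hφR T x (by rw [abs_of_nonneg hT0]; linarith)

theorem integral_density (t : ℝ) {f : ℝ → ℝ} (hf : Measurable f) :
    ∫ x, f x ∂D.density t = ∫ s, f (D.flow t s) ∂D.μ :=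
  integral_map (D.measurable_flow_right t).aemeasurable hf.aestronglyMeasurable

theorem weak_mass (hφ : ContDiff ℝ ∞ (Function.uncurry φ))
    (hc : HasCompactSupport (Function.uncurry φ)) :
    ∫ t in Ioi (0 : ℝ), ∫ x, (deriv (fun s => φ s x) t + D.velocity t x * deriv (φ t) x)
      ∂D.density t = -∫ s, φ 0 s ∂D.μ := by
  have h := D.integral_integral_lagrangian hφ hc (α := fun _ => 1) (β := fun _ => 0)
    continuous_const continuous_const
  simp only [one_mul] at h
  rw [← h]
  refine setIntegral_congr_fun measurableSet_Ioi fun t _ => ?_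
  have hm : Measurable fun x => deriv (fun s => φ s x) t + D.velocity t x * deriv (φ t) x :=
    ((continuous_deriv_left hφ).comp (Continuous.prodMk_right t)).measurable.add
      ((D.measurable_velocity_right t).mul
        ((continuous_deriv_right hφ).comp (Continuous.prodMk_right t)).measurable)
  simp only [D.integral_density t hm, lagrangian]
  congr 1
  funext s
  ring

/-- With `α = u0` and `β = κ * mass` the carried quantity is `vel`. The two averaging identities
convert the Lagrangian integrand, at each time, into the Eulerian one. -/
theorem weak_momentum (hφ : ContDiff ℝ ∞ (Function.uncurry φ))
    (hc : HasCompactSupport (Function.uncurry φ)) :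
    ∫ t in Ioi (0 : ℝ), ∫ x, (D.velocity t x * deriv (fun s => φ s x) t +
      D.velocity t x ^ 2 * deriv (φ t) x + D.κ * electricField (D.density t) x * φ t x)
      ∂D.density t = -∫ s, D.u0 s * φ 0 s ∂D.μ := by
  rw [← D.integral_integral_lagrangian hφ hc (α := D.u0) (β := fun s => D.κ * D.mass s)
    D.continuous_u0 (continuous_const.mul D.continuous_mass)]
  obtain ⟨R, K, hR0, hK0, hout, hK⟩ := exists_test_bounds hφ hc
  refine setIntegral_congr_fun measurableSet_Ioi fun t ht => ?_
  have ht0 : 0 ≤ t := le_of_lt ht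
  obtain ⟨L, hL0, hL⟩ := D.exists_abs_velocity_le R t
  have hT := D.measurable_flow_right t
  have hu := D.measurable_velocity_right t
  have hl : Measurable fun x => deriv (fun s => φ s x) t :=
    ((continuous_deriv_left hφ).comp (Continuous.prodMk_right t)).measurable
  have hr : Measurable (deriv (φ t)) :=
    ((continuous_deriv_right hφ).comp (Continuous.prodMk_right t)).measurable
  have hφt : Measurable (φ t) := (hφ.continuous.comp (Continuous.prodMk_right t)).measurable
  have hE := measurable_electricField (D.density t)
  -- The derivative of `φ` along the velocity field depends on the label only through its position,
  -- so averaging applies.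
  obtain ⟨h, hh⟩ : ∃ h : ℝ → ℝ, h = fun x => deriv (fun s => φ s x) t +
    D.velocity t x * deriv (φ t) x := ⟨_, rfl⟩
  have hm : Measurable h := hh ▸ hl.add (hu.mul hr)
  have hRh : ∀ x, R < |x| → h x = 0 := by
    intro x hx
    obtain ⟨-, h1, h2⟩ := hout t x (Or.inr hx)
    rw [hh]
    simp only [h1, h2]
    ring
  have hvb : ∀ᵐ s ∂D.μ, |D.flow t s| ≤ R → |D.velocity t (D.flow t s)| ≤ L := by
    filter_upwards [D.ae_interior, D.ae_generic] with s hs hg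
    exact hL t s ht0 le_rfl hs hg
  have hKh : ∀ᵐ s ∂D.μ, |h (D.flow t s)| ≤ K + L * K := by
    filter_upwards [hvb] with s hs
    rcases le_or_gt |D.flow t s| R with hle | hlt
    · rw [hh]
      refine (abs_add_le _ _).trans ?_
      rw [abs_mul]
      have := hs hle
      obtain ⟨-, h2, h3⟩ := hK t (D.flow t s)
      gcongr
    · rw [hRh _ hlt, abs_zero]
      positivity
  have i1 : Integrable (fun s => D.velocity t (D.flow t s) * h (D.flow t s)) D.μ := by
    refine Integrable.of_bound ((hu.comp hT).mul (hm.comp hT)).aestronglyMeasurable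
      (L * (K + L * K)) ?_
    filter_upwards [hvb, hKh] with s hs hs'
    rcases le_or_gt |D.flow t s| R with hle | hlt
    · rw [norm_mul]
      exact mul_le_mul (hs hle) hs' (norm_nonneg _) hL0
    · rw [hRh _ hlt, mul_zero, norm_zero]
      positivity
  have i2 : Integrable (fun s => electricField (D.density t) (D.flow t s) * φ t (D.flow t s))
      D.μ :=
    D.integrable_electricField_mul hφt fun x => (hK t x).1
  have i3 : Integrable (fun s => D.mass s * φ t (D.flow t s)) D.μ :=
    D.integrable_mass_mul hφt fun x => (hK t x).1
  have hmeas : Measurable fun x => D.velocity t x * deriv (fun s => φ s x) t +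
      D.velocity t x ^ 2 * deriv (φ t) x + D.κ * electricField (D.density t) x * φ t x :=
    ((hu.mul hl).add ((hu.pow_const 2).mul hr)).add ((hE.const_mul D.κ).mul hφt)
  calc _ = ∫ s, (D.velocity t (D.flow t s) * h (D.flow t s) +
        D.κ * (electricField (D.density t) (D.flow t s) * φ t (D.flow t s))) ∂D.μ := by
        simp only [D.integral_density t hmeas]
        congr 1
        funext s
        rw [hh]
        ring
    _ = ∫ s, (D.vel t s * h (D.flow t s) + D.κ * (D.mass s * φ t (D.flow t s))) ∂D.μ := by
        rw [integral_add i1 (i2.const_mul _), integral_const_mul,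
          D.integral_velocity_mul ht0 hm hRh hKh,
          D.integral_electricField_mul ht0 hφt fun x => (hK t x).1,
          integral_add (D.integrable_vel_mul ht0 hm hRh hKh) (i3.const_mul _),
          integral_const_mul]
    _ = _ := by
        simp only [lagrangian]
        congr 1
        funext s
        rw [hh, vel]
        ring

end InitialData
end EulerPoisson

namespace EulerPoisson
namespace InitialData

variable (D : InitialData)

/-! ### Cumulative mass and momentum -/

theorem ae_flow_le_iff {x t b : ℝ} (ht : 0 ≤ t) (hb : D.IsMin x t b)
    (hmax : ∀ y, D.IsMin x t y → D.mass y ≤ D.mass b) :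
    ∀ᵐ s ∂D.μ, D.flow t s ≤ x ↔ s ≤ b := by
  filter_upwards [D.ae_interior, D.ae_generic] with s hs hg
  rw [hs.flow_le_iff_of_greatest ht hb hmax, hg.mass_le_iff]

theorem integral_sub_integral_eq {x x' t b b' : ℝ} {w : ℝ → ℝ} (hw : Continuous w) (ht : 0 ≤ t)
    (hx : x ≤ x') (hb : D.IsMin x t b) (hmax : ∀ y, D.IsMin x t y → D.mass y ≤ D.mass b)
    (hb' : D.IsMin x' t b') (hmax' : ∀ y, D.IsMin x' t y → D.mass y ≤ D.mass b') :
    (∫ s in (0 : ℝ)..b', w s ∂D.μ) - ∫ s in (0 : ℝ)..b, w s ∂D.μ =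
      ∫ s, (D.flow t ⁻¹' Ioc x x').indicator w s ∂D.μ := by
  have hae : D.flow t ⁻¹' Ioc x x' =ᵐ[D.μ] Ioc b b' := by
    rw [eventuallyEq_set]
    filter_upwards [D.ae_flow_le_iff ht hb hmax, D.ae_flow_le_iff ht hb' hmax'] with s h1 h2
    rw [mem_preimage, mem_Ioc, mem_Ioc, h2, ← not_le, h1, not_le]
  rw [intervalIntegral.integral_interval_sub_left (hw.intervalIntegrable _ _)
    (hw.intervalIntegrable _ _),
    integral_indicator (D.measurable_flow_right t measurableSet_Ioc), setIntegral_congr_set hae]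
  rcases le_or_gt b b' with h | h
  · rw [intervalIntegral.integral_of_le h]
  -- The greatest minimizers are unique only in mass, so `b' < b` may occur, across an interval
  -- without mass.
  · have hm : D.mass b = D.mass b' := by
      refine le_antisymm ?_ (D.mass_mono h.le)
      rcases hx.eq_or_lt with rfl | hlt
      · exact hmax' b hb
      · exact hb.mass_le hb' hlt
    rw [D.integral_eq_zero_of_mass_eq hm, Ioc_eq_empty h.not_gt, setIntegral_empty]

theorem ae_abs_velocity_le (R T : ℝ) : ∃ L, 0 ≤ L ∧ ∀ t, 0 ≤ t → t ≤ T →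
    ∀ᵐ x ∂D.density t, |x| ≤ R → |D.velocity t x| ≤ L := by
  obtain ⟨L, hL0, hL⟩ := D.exists_abs_velocity_le R T
  refine ⟨L, hL0, fun t h0 hT => ?_⟩
  have hset : MeasurableSet {x | |x| ≤ R → |D.velocity t x| ≤ L} := by
    have h1 : MeasurableSet {x : ℝ | |x| ≤ R} := measurableSet_le measurable_norm measurable_const
    have h2 : MeasurableSet {x | |D.velocity t x| ≤ L} :=
      measurableSet_le (D.measurable_velocity_right t).norm measurable_const
    exact h1.imp h2
  rw [density, ae_map_iff (D.measurable_flow_right t).aemeasurable hset]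
  filter_upwards [D.ae_interior, D.ae_generic] with s hs hg
  exact hL t s h0 hT hs hg

theorem locallyIntegrable_velocity {t : ℝ} (ht : 0 ≤ t) :
    LocallyIntegrable (D.velocity t) (D.density t) := by
  rw [locallyIntegrable_iff]
  intro K hK
  obtain ⟨R, hR⟩ := hK.isBounded.exists_norm_le
  obtain ⟨L, hL0, hL⟩ := D.ae_abs_velocity_le R t
  refine Measure.integrableOn_of_bounded (M := L) (measure_ne_top _ _)
    (D.measurable_velocity_right t).aestronglyMeasurable
    ((ae_restrict_iff' hK.measurableSet).2 ?_)
  filter_upwards [hL t ht le_rfl] with x hx hxK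
  exact hx (hR x hxK)

theorem lintegral_energy_lt_top (T R : ℝ) :
    ∫⁻ t in Icc 0 T, ∫⁻ x in Icc (-R) R,
      ENNReal.ofReal (1 + D.velocity t x ^ 2 + |electricField (D.density t) x|) ∂D.density t
        < ⊤ := by
  obtain ⟨L, hL0, hL⟩ := D.ae_abs_velocity_le R T
  have hb : ∀ t ∈ Icc 0 T, ∫⁻ x in Icc (-R) R,
      ENNReal.ofReal (1 + D.velocity t x ^ 2 + |electricField (D.density t) x|) ∂D.density t ≤
        ENNReal.ofReal (1 + L ^ 2 + D.total) * D.μ univ := by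
    intro t ht
    have h1 : ∀ᵐ x ∂(D.density t).restrict (Icc (-R) R),
        ENNReal.ofReal (1 + D.velocity t x ^ 2 + |electricField (D.density t) x|) ≤
          ENNReal.ofReal (1 + L ^ 2 + D.total) := by
      rw [ae_restrict_iff' measurableSet_Icc]
      filter_upwards [hL t ht.1 ht.2] with x hx hxR
      have h2 := hx (abs_le.2 hxR)
      have h3 := D.abs_electricField_density_le t x
      have h4 : D.velocity t x ^ 2 ≤ L ^ 2 := sq_le_sq' (abs_le.1 h2).1 (abs_le.1 h2).2
      exact ENNReal.ofReal_le_ofReal (by linarith)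
    refine (lintegral_mono_ae h1).trans ?_
    rw [lintegral_const]
    refine mul_le_mul_right ((Measure.restrict_apply_le _ _).trans ?_) _
    rw [density, Measure.map_apply (D.measurable_flow_right t) MeasurableSet.univ, preimage_univ]
  refine (setLIntegral_mono measurable_const hb).trans_lt ?_
  rw [setLIntegral_const]
  exact ENNReal.mul_lt_top (ENNReal.mul_lt_top ENNReal.ofReal_lt_top (measure_lt_top _ _))
    measure_Icc_lt_top

/-- A function that cumulates `w` along the flow has the image of `w` as its derivative. -/
theorem hasDistribDeriv_of_sub_eq {t : ℝ} (ht : 0 ≤ t) {w f g : ℝ → ℝ} (hw : Continuous w)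
    (hf : ∀ a b, a ≤ b → f b - f a = ∫ s, (D.flow t ⁻¹' Ioc a b).indicator w s ∂D.μ)
    (hgm : Measurable g) (hg : LocallyIntegrable g (D.density t))
    (hgw : ∀ φ : ℝ → ℝ, ContDiff ℝ ∞ φ → HasCompactSupport φ →
      ∫ s, φ (D.flow t s) * g (D.flow t s) ∂D.μ = ∫ s, φ (D.flow t s) * w s ∂D.μ) :
    HasDistribDeriv f (D.density t) g := by
  have hT := D.measurable_flow_right t
  have hint : ∀ R, Integrable ((D.flow t ⁻¹' Icc (-R) R).indicator w) D.μ := by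
    intro R
    obtain ⟨S, hS0, hS⟩ := D.exists_mem_Icc_of_abs_flow_le R t
    obtain ⟨C, hC⟩ := (isCompact_Icc (a := -S) (b := S)).exists_bound_of_continuousOn
      hw.continuousOn
    have hC0 : 0 ≤ C := (norm_nonneg _).trans (hC 0 ⟨by linarith, hS0⟩)
    refine Integrable.of_bound
      (hw.measurable.indicator (hT measurableSet_Icc)).aestronglyMeasurable C ?_
    filter_upwards [D.ae_interior, D.ae_generic] with s hs hgen
    by_cases hm : s ∈ D.flow t ⁻¹' Icc (-R) R
    · rw [indicator_of_mem hm]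
      exact hC s (hS t s ht le_rfl hs hgen (abs_le.2 hm))
    · rw [indicator_of_notMem hm, norm_zero]
      exact hC0
  refine ⟨locallyIntegrable_of_sub_eq hT hw.measurable hint hf, hg, fun φ hφ hc => ?_⟩
  have hm : Measurable fun x => φ x * g x := hφ.continuous.measurable.mul hgm
  rw [integral_mul_deriv_of_sub_eq hT hw.measurable hint hf hφ hc, D.integral_density t hm,
    ← hgw φ hφ hc]

end InitialData

/-! ### Absolutely continuous initial data -/

/-- The measure with density `ρ₀`. -/
def massMeasure (ρ0 : ℝ → ℝ) : Measure ℝ := volume.withDensity fun s => ENNReal.ofReal (ρ0 s)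

section Bridge

variable {κ : ℝ} {u0 ρ0 : ℝ → ℝ}

theorem isFiniteMeasure_massMeasure (hρ0 : Integrable ρ0) : IsFiniteMeasure (massMeasure ρ0) :=
  isFiniteMeasure_withDensity_ofReal hρ0.2

theorem nullSingletonClass_massMeasure (ρ0 : ℝ → ℝ) : NullSingletonClass (massMeasure ρ0) :=
  ⟨fun x => withDensity_absolutelyContinuous _ _ (measure_singleton x)⟩

theorem integral_massMeasure (hρ0 : Integrable ρ0) (hpos : ∀ᵐ s, 0 ≤ ρ0 s) (f : ℝ → ℝ) :
    ∫ s, f s ∂massMeasure ρ0 = ∫ s, f s * ρ0 s := by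
  rw [massMeasure, integral_withDensity_eq_integral_toReal_smul₀
    hρ0.aestronglyMeasurable.aemeasurable.ennreal_ofReal
    (Eventually.of_forall fun _ => ENNReal.ofReal_lt_top)]
  refine integral_congr_ae ?_
  filter_upwards [hpos] with s hs
  rw [ENNReal.toReal_ofReal hs, smul_eq_mul, mul_comm]

theorem setIntegral_massMeasure (hρ0 : Integrable ρ0) (hpos : ∀ᵐ s, 0 ≤ ρ0 s) (f : ℝ → ℝ)
    {A : Set ℝ} (hA : MeasurableSet A) :
    ∫ s in A, f s ∂massMeasure ρ0 = ∫ s in A, f s * ρ0 s := by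
  rw [← integral_indicator hA, ← integral_indicator hA, integral_massMeasure hρ0 hpos]
  congr 1
  funext s
  by_cases h : s ∈ A <;> simp [h]

theorem intervalIntegral_massMeasure (hρ0 : Integrable ρ0) (hpos : ∀ᵐ s, 0 ≤ ρ0 s) (f : ℝ → ℝ)
    (a b : ℝ) : ∫ s in a..b, f s ∂massMeasure ρ0 = ∫ s in a..b, f s * ρ0 s := by
  simp only [intervalIntegral, setIntegral_massMeasure hρ0 hpos f measurableSet_Ioc]

theorem measureReal_massMeasure_Iic (hρ0 : Integrable ρ0) (hpos : ∀ᵐ s, 0 ≤ ρ0 s) (s : ℝ) :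
    (massMeasure ρ0).real (Iic s) = E0 ρ0 s := by
  have := setIntegral_massMeasure hρ0 hpos (fun _ => 1) (measurableSet_Iic (a := s))
  simpa [E0] using this

theorem objective_eq (hρ0 : Integrable ρ0) (hpos : ∀ᵐ s, 0 ≤ ρ0 s) (x t y : ℝ) :
    objective κ u0 ρ0 x t y = ∫ s in (0 : ℝ)..y, (s + t * u0 s +
      1 / 2 * κ * (massMeasure ρ0).real (Iic s) * t ^ 2 - x) ∂massMeasure ρ0 := by
  simp only [intervalIntegral_massMeasure hρ0 hpos, measureReal_massMeasure_Iic hρ0 hpos]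
  rfl

/-- The abstract data belonging to an integrable initial density. -/
def initialData (κ : ℝ) (hu0 : Continuous u0) (hρ0 : Integrable ρ0) (hpos : ∀ᵐ s, 0 ≤ ρ0 s)
    (hmin : ∀ x t : ℝ, 0 ≤ t → (minimizers κ u0 ρ0 x t).Nonempty) : InitialData where
  κ := κ
  u0 := u0
  μ := massMeasure ρ0
  continuous_u0 := hu0
  isFiniteMeasure := isFiniteMeasure_massMeasure hρ0
  nullSingleton := nullSingletonClass_massMeasure ρ0
  exists_min x t ht := by
    obtain ⟨y, hy⟩ := hmin x t ht
    refine ⟨y, fun z => ?_⟩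
    rw [← objective_eq hρ0 hpos, ← objective_eq hρ0 hpos]
    exact hy z

variable (hu0 : Continuous u0) (hρ0 : Integrable ρ0) (hpos : ∀ᵐ s, 0 ≤ ρ0 s)
  (hmin : ∀ x t : ℝ, 0 ≤ t → (minimizers κ u0 ρ0 x t).Nonempty)

theorem initialData_mass (s : ℝ) : (initialData κ hu0 hρ0 hpos hmin).mass s = E0 ρ0 s :=
  measureReal_massMeasure_Iic hρ0 hpos s

theorem initialData_isMin (x t y : ℝ) :
    (initialData κ hu0 hρ0 hpos hmin).IsMin x t y ↔ y ∈ minimizers κ u0 ρ0 x t := by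
  have h : ∀ y, (initialData κ hu0 hρ0 hpos hmin).cost x t y = objective κ u0 ρ0 x t y :=
    fun y => (objective_eq hρ0 hpos x t y).symm
  simp only [InitialData.IsMin, h]
  rfl

/-- Integrals up to the largest minimizer can be computed with any minimizer of largest mass. -/
theorem integralTo_yMax_eq {x t b : ℝ}
    (hb : (initialData κ hu0 hρ0 hpos hmin).IsMin x t b)
    (hmax : ∀ y, (initialData κ hu0 hρ0 hpos hmin).IsMin x t y →
      (initialData κ hu0 hρ0 hpos hmin).mass y ≤ (initialData κ hu0 hρ0 hpos hmin).mass b)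
    (f : ℝ → ℝ) : integralTo (fun s => f s * ρ0 s) (yMax κ u0 ρ0 x t) =
      ∫ s in (0 : ℝ)..b, f s ∂massMeasure ρ0 := by
  obtain ⟨D, hD⟩ : ∃ D, D = initialData κ hu0 hρ0 hpos hmin := ⟨_, rfl⟩
  have hμ : D.μ = massMeasure ρ0 := by rw [hD]; rfl
  have hmin' : ∀ y, D.IsMin x t y ↔ y ∈ minimizers κ u0 ρ0 x t := fun y => by
    rw [hD]; exact initialData_isMin hu0 hρ0 hpos hmin x t y
  rw [← hD] at hb hmax
  set Y := yMax κ u0 ρ0 x t with hY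
  have hbY : (b : EReal) ≤ Y := le_sSup ⟨b, (hmin' b).1 hb, rfl⟩
  -- A label below `Y` lies below some minimizer, whose mass is at most that of `b`. A label that is
  -- also above `b` thus has the mass of `b`, and such labels are null.
  have hae : ∀ᵐ s : ℝ ∂massMeasure ρ0, (s : EReal) ≤ Y ↔ s ≤ b := by
    have h1 : ∀ᵐ s : ℝ ∂D.μ, (s : EReal) ≠ Y := by
      have : {s : ℝ | (s : EReal) = Y}.Subsingleton := fun p hp q hq =>
        EReal.coe_injective ((show (p : EReal) = Y from hp).trans
          (show (q : EReal) = Y from hq).symm)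
      have h0 := this.measure_zero D.μ
      rw [ae_iff]
      simpa only [ne_eq, not_not] using h0
    have h2 : ∀ᵐ s ∂D.μ, D.mass s ≠ D.mass b := by
      rw [ae_iff]; simpa using D.measure_mass_eq (D.mass b)
    rw [← hμ]
    filter_upwards [h1, h2] with s hs1 hs2
    refine ⟨fun hle => ?_, fun hle => (EReal.coe_le_coe_iff.2 hle).trans hbY⟩
    by_contra hlt
    obtain ⟨_, ⟨y, hy, rfl⟩, hsy⟩ := lt_sSup_iff.1 (hle.lt_of_ne hs1)
    have h3 := hmax y ((hmin' y).2 hy)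
    have h4 := D.mass_mono (EReal.coe_lt_coe_iff.1 hsy).le
    exact hs2 ((h4.trans h3).antisymm (D.mass_mono (not_le.1 hlt).le))
  have hle : MeasurableSet {s : ℝ | (s : EReal) ≤ Y} :=
    measurableSet_le measurable_coe_real_ereal measurable_const
  have m1 : MeasurableSet {s : ℝ | 0 < s ∧ (s : EReal) ≤ Y} := measurableSet_Ioi.inter hle
  have m2 : MeasurableSet {s : ℝ | Y < (s : EReal) ∧ s ≤ 0} :=
    (measurableSet_lt measurable_const measurable_coe_real_ereal).inter measurableSet_Iic
  rw [integralTo, ← setIntegral_massMeasure hρ0 hpos f m1, ← setIntegral_massMeasure hρ0 hpos f m2,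
    intervalIntegral]
  congr 1
  · refine setIntegral_congr_set ?_
    rw [eventuallyEq_set]
    filter_upwards [hae] with s hs
    exact and_congr_right fun _ => hs
  · refine setIntegral_congr_set ?_
    rw [eventuallyEq_set]
    filter_upwards [hae] with s hs
    refine and_congr_left fun _ => ?_
    rw [← not_le, hs, not_le]

end Bridge

/-! ### Existence of minimizers -/

/-- Where `ρ0 ≠ 0`, the distance of `Q` from `s` is at most `S`. Hence `Q * ρ0` is nonpositive left
of `-S` and nonnegative right of `S`, and a minimizer over `[-S, S]` is global. -/
theorem minimizers_nonempty {κ : ℝ} {u0 ρ0 : ℝ → ℝ} (hu0 : Continuous u0) (hρ0 : Integrable ρ0)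
    (hpos : ∀ᵐ s, 0 ≤ ρ0 s) {C : ℝ} (hC : ∀ᵐ s, ρ0 s ≠ 0 → |u0 s| ≤ C) (x t : ℝ) :
    (minimizers κ u0 ρ0 x t).Nonempty := by
  have hE : Continuous (E0 ρ0) := by
    have h : E0 ρ0 = fun s => E0 ρ0 0 + ∫ w in (0 : ℝ)..s, ρ0 w := by
      funext s
      rw [← intervalIntegral.integral_Iic_sub_Iic hρ0.integrableOn hρ0.integrableOn]
      simp [E0]
    rw [h]
    exact continuous_const.add (intervalIntegral.continuous_primitive
      (fun a b => hρ0.intervalIntegrable) 0)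
  have hQ : Continuous (Q κ u0 ρ0 x t) := by
    unfold Q; fun_prop
  have hii : ∀ a b, IntervalIntegrable (fun s => Q κ u0 ρ0 x t s * ρ0 s) volume a b := fun a b =>
    (hρ0.intervalIntegrable).continuousOn_mul hQ.continuousOn
  have hobj : Continuous (objective κ u0 ρ0 x t) := intervalIntegral.continuous_primitive hii 0
  obtain ⟨I, hI⟩ : ∃ I, I = ∫ w, ρ0 w := ⟨_, rfl⟩
  have hEI : ∀ s, |E0 ρ0 s| ≤ I := by
    intro s
    rw [E0, abs_of_nonneg (setIntegral_nonneg_of_ae hpos), hI]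
    exact setIntegral_le_integral hρ0 hpos
  have hI0 : 0 ≤ I := (abs_nonneg _).trans (hEI 0)
  obtain ⟨S, hS⟩ : ∃ S, S = |t| * |C| + |κ| * I * t ^ 2 + |x| := ⟨_, rfl⟩
  have hS0 : 0 ≤ S := by rw [hS]; positivity
  have hQb : ∀ᵐ s, ρ0 s ≠ 0 → |Q κ u0 ρ0 x t s - s| ≤ S := by
    filter_upwards [hC] with s hs h0
    have e : Q κ u0 ρ0 x t s - s = t * u0 s + 1 / 2 * κ * E0 ρ0 s * t ^ 2 - x := by
      rw [Q]; ring
    have h1 : |t * u0 s| ≤ |t| * |C| := by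
      rw [abs_mul]
      exact mul_le_mul_of_nonneg_left ((hs h0).trans (le_abs_self C)) (abs_nonneg t)
    have h2 : |1 / 2 * κ * E0 ρ0 s * t ^ 2| ≤ |κ| * I * t ^ 2 := by
      rw [abs_mul, abs_mul, abs_mul, abs_of_nonneg (sq_nonneg t)]
      have h3 : |(1 / 2 : ℝ)| = 1 / 2 := by norm_num
      rw [h3]
      gcongr
      · linarith [abs_nonneg κ]
      · exact hEI s
    rw [e, hS]
    refine (abs_sub _ _).trans ?_
    gcongr
    exact (abs_add_le _ _).trans (by gcongr)
  obtain ⟨y, hy, hmin⟩ := (isCompact_Icc (a := -S) (b := S)).exists_isMinOn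
    ⟨0, by linarith, hS0⟩ hobj.continuousOn
  have hsub : ∀ a b, objective κ u0 ρ0 x t b - objective κ u0 ρ0 x t a =
      ∫ s in a..b, Q κ u0 ρ0 x t s * ρ0 s := fun a b =>
    intervalIntegral.integral_interval_sub_left (hii _ _) (hii _ _)
  refine ⟨y, fun z => ?_⟩
  rcases lt_or_ge z (-S) with h1 | h1
  · refine (hmin ⟨le_rfl, by linarith⟩).trans ?_
    have h2 : 0 ≤ ∫ s in z..(-S), -(Q κ u0 ρ0 x t s * ρ0 s) := by
      refine intervalIntegral.integral_nonneg_of_ae_restrict h1.le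
        ((ae_restrict_iff' measurableSet_Icc).2 ?_)
      filter_upwards [hQb, hpos] with s hs hp hmem
      by_cases h0 : ρ0 s = 0
      · simp [h0]
      · have := (abs_le.1 (hs h0)).2
        exact neg_nonneg.2 (mul_nonpos_of_nonpos_of_nonneg (by linarith [hmem.2]) hp)
    rw [intervalIntegral.integral_neg, ← hsub] at h2
    linarith
  rcases lt_or_ge S z with h2 | h2
  · refine (hmin ⟨by linarith, le_rfl⟩).trans ?_
    have h3 : 0 ≤ ∫ s in S..z, Q κ u0 ρ0 x t s * ρ0 s := by
      refine intervalIntegral.integral_nonneg_of_ae_restrict h2.le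
        ((ae_restrict_iff' measurableSet_Icc).2 ?_)
      filter_upwards [hQb, hpos] with s hs hp hmem
      by_cases h0 : ρ0 s = 0
      · simp [h0]
      · have := (abs_le.1 (hs h0)).1
        exact mul_nonneg (by linarith [hmem.1]) hp
    rw [← hsub] at h3
    linarith
  · exact hmin ⟨h1, h2⟩

end EulerPoisson

/-! ### The weak solution for an integrable initial density -/

namespace EulerPoisson

section Solution

variable {κ : ℝ} {u0 ρ0 : ℝ → ℝ} (hu0 : Continuous u0) (hρ0 : Integrable ρ0)
  (hpos : ∀ᵐ s, 0 ≤ ρ0 s)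
  (hmin : ∀ x t : ℝ, 0 ≤ t → (minimizers κ u0 ρ0 x t).Nonempty)

theorem isWeakSolution_initialData :
    IsWeakSolution κ u0 ρ0 (initialData κ hu0 hρ0 hpos hmin).density
      (initialData κ hu0 hρ0 hpos hmin).velocity where
  finite _ := inferInstance
  measurable_density := InitialData.measurable_density _
  measurable_velocity := InitialData.measurable_velocity _
  locally_integrable := InitialData.lintegral_energy_lt_top _
  field_deriv _ _ := hasDistribDeriv_electricField _
  field_atBot _ _ := tendsto_electricField_atBot _
  mass_eq φ hφ hc := by
    rw [InitialData.weak_mass _ hφ hc, neg_add_eq_zero]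
    exact integral_massMeasure hρ0 hpos _
  momentum_eq φ hφ hc := by
    have h := InitialData.weak_momentum (initialData κ hu0 hρ0 hpos hmin) hφ hc
    have e : ∫ s, u0 s * φ 0 s ∂massMeasure ρ0 = ∫ x, φ 0 x * (ρ0 x * u0 x) := by
      rw [integral_massMeasure hρ0 hpos]
      congr 1
      funext s
      ring
    rw [← e]
    exact add_eq_zero_iff_eq_neg.2 h

theorem hasDistribDeriv_mass {t : ℝ} (ht : 0 ≤ t) :
    HasDistribDeriv (mass κ u0 ρ0 t) ((initialData κ hu0 hρ0 hpos hmin).density t)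
      fun _ => 1 := by
  refine InitialData.hasDistribDeriv_of_sub_eq _ ht (w := fun _ => 1) continuous_const
    (fun x x' hx => ?_) measurable_const (locallyIntegrable_const 1) fun _ _ _ => rfl
  obtain ⟨b, hb, hmax⟩ := (initialData κ hu0 hρ0 hpos hmin).exists_greatest_isMin x ht
  obtain ⟨b', hb', hmax'⟩ := (initialData κ hu0 hρ0 hpos hmin).exists_greatest_isMin x' ht
  rw [← InitialData.integral_sub_integral_eq _ continuous_const ht hx hb hmax hb' hmax']
  have h1 := integralTo_yMax_eq hu0 hρ0 hpos hmin hb hmax fun _ => 1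
  have h2 := integralTo_yMax_eq hu0 hρ0 hpos hmin hb' hmax' fun _ => 1
  simp only [one_mul] at h1 h2
  exact congrArg₂ (· - ·) h2 h1

/-- The increments of the momentum cumulate `vel` over labels; tested against functions of position,
`vel` averages to the velocity field. -/
theorem hasDistribDeriv_momentum {t : ℝ} (ht : 0 ≤ t) :
    HasDistribDeriv (momentum κ u0 ρ0 t) ((initialData κ hu0 hρ0 hpos hmin).density t)
      ((initialData κ hu0 hρ0 hpos hmin).velocity t) := by
  obtain ⟨D, hD⟩ : ∃ D, D = initialData κ hu0 hρ0 hpos hmin := ⟨_, rfl⟩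
  rw [← hD]
  refine D.hasDistribDeriv_of_sub_eq ht (w := D.vel t) (D.continuous_vel_right t)
    (fun x x' hx => ?_) (D.measurable_velocity_right t) (D.locallyIntegrable_velocity ht)
    fun φ hφ hc => ?_
  · obtain ⟨b, hb, hmax⟩ := D.exists_greatest_isMin x ht
    obtain ⟨b', hb', hmax'⟩ := D.exists_greatest_isMin x' ht
    rw [← D.integral_sub_integral_eq (D.continuous_vel_right t) ht hx hb hmax hb' hmax']
    have hvel : D.vel t = fun s => u0 s + κ * E0 ρ0 s * t := by
      funext s
      rw [InitialData.vel, hD, initialData_mass]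
      rfl
    rw [hvel]
    subst hD
    exact congrArg₂ (· - ·) (integralTo_yMax_eq hu0 hρ0 hpos hmin hb' hmax' _)
      (integralTo_yMax_eq hu0 hρ0 hpos hmin hb hmax _)
  · obtain ⟨R, hR⟩ := hc.isCompact.isBounded.exists_norm_le
    obtain ⟨K, hK⟩ := hφ.continuous.bounded_above_of_compact_support hc
    have h := D.integral_velocity_mul ht hφ.continuous.measurable (R := R) (K := K)
      (fun x hx => by
        by_contra hne
        exact (hR x (subset_tsupport _ hne)).not_gt hx)
      (Eventually.of_forall fun s => hK _)
    simpa only [mul_comm] using h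

end Solution

end EulerPoisson

end

theorem theorem1p1 (κ : ℝ) (u0 ρ0 : ℝ → ℝ) (hu0 : ContDiff ℝ 1 u0)
    (hρ0 : Integrable ρ0 volume) (hpos : ∀ᵐ s ∂(volume : Measure ℝ), 0 ≤ ρ0 s) :
    ((∃ C : ℝ, ∀ᵐ s ∂(volume : Measure ℝ), ρ0 s ≠ 0 → |u0 s| ≤ C) →
      ∀ x t : ℝ, 0 ≤ t → (EulerPoisson.minimizers κ u0 ρ0 x t).Nonempty) ∧
    ((∀ x t : ℝ, 0 ≤ t → (EulerPoisson.minimizers κ u0 ρ0 x t).Nonempty) →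
      ∃ (ρ : ℝ → Measure ℝ) (u : ℝ → ℝ → ℝ),
        EulerPoisson.IsWeakSolution κ u0 ρ0 ρ u ∧
        ∀ t : ℝ, 0 ≤ t →
          EulerPoisson.HasDistribDeriv (EulerPoisson.mass κ u0 ρ0 t) (ρ t) (fun _ => 1) ∧
          EulerPoisson.HasDistribDeriv (EulerPoisson.momentum κ u0 ρ0 t) (ρ t) (u t)) := by
  refine ⟨fun ⟨C, hC⟩ x t _ => EulerPoisson.minimizers_nonempty hu0.continuous hρ0 hpos hC x t,
    fun hmin => ⟨_, _,
      EulerPoisson.isWeakSolution_initialData hu0.continuous hρ0 hpos hmin, fun t ht =>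
        ⟨EulerPoisson.hasDistribDeriv_mass hu0.continuous hρ0 hpos hmin ht,
          EulerPoisson.hasDistribDeriv_momentum hu0.continuous hρ0 hpos hmin ht⟩⟩⟩
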